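/- Let $d\ge 1$ and let $(\mathbf A_n,\mathbf b_n)_{n\ge 1}$ be an i.i.d. sequence of random variables with values in $\mathbb R^{d\times d}\times\mathbb R^d$; put $\bar A=\mathbb E[\mathbf A_1]$, $\bar b=\mathbb E[\mathbf b_1]$. Assume that (i) there is $C_{\mathbf b}>0$ such that, for every unit vector $u$, $u^\top(\mathbf b_1-\bar b)$ is sub-Gaussian with variance factor $C_{\mathbf b}^2$, i.e. $\log\mathbb E[e^{\lambda u^\top(\mathbf b_1-\bar b)}]\le \lambda^2C_{\mathbf b}^2/2$ for all $\lambda\in\mathbb R$; (ii) there is $C_{\mathbf A}>0$ such that $\|\mathbf A_1\|\le C_{\mathbf A}$ almost surely (spectral norm); (iii) $-\bar A$ is Hurwitz, i.e. every eigenvalue $\lambda\in\mathbb C$ of $\bar A$ satisfies $\mathrm{Re}(\lambda)>0$. For $\alpha>0$ let $R_\alpha$ be the Markov kernel of the recursion $\theta_{n+1}=\theta_n-\alpha\{\mathbf A_{n+1}\theta_n-\mathbf b_{n+1}\}$, i.e. $R_\alpha(\theta,\cdot)$ is the law of $\theta-\alpha(\mathbf A_1\theta-\mathbf b_1)$. Then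 the following objects are well defined: - the unique solution $\theta^\star$ of $\bar A\theta=\bar b$; - the unique positive definite $Q$ with $\bar A^\top Q+Q\bar A=\mathrm I$, and the number $\alpha_{2,\infty}=\min\{\alpha_\infty,\ a/(2b_Q^2)\}>0$, where $a=\|Q\|^{-1}/2$, $\alpha_\infty=\tfrac12\|\bar A\|_Q^{-2}\|Q\|^{-1}$, $b_Q=2\sqrt{\kappa_Q}\,C_{\mathbf A}$, $\kappa_Q=\lambda_{\max}(Q)/\lambda_{\min}(Q)$, $\|x\|_Q=(x^\top Qx)^{1/2}$ and $\|M\|_Q=\max_{\|x\|_Q=1}\|Mx\|_Q$; - the unique solution $\Sigma$ of the Lyapunov equation $\bar A\Sigma+\Sigma\bar A^\top=\Sigma_\varepsilon$, where $\Sigma_\varepsilon=\mathbb E[\varepsilon_1\varepsilon_1^\top]$ and $\varepsilon_1=\mathbf b_1-\bar b-(\mathbf A_1-\bar A)\theta^\star$; this $\Sigma$ is symmetric positive semidefinite; - for every $\alpha\in(0,\alpha_{2,\infty}]$, the unique stationary distribution $\pi_\alpha$ of $R_\alpha$, which has a finite second moment. For $\alpha\in(0,\alpha_{2,\infty}]$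 let $\theta_\infty^{(\alpha)}$ be any random vector with law $\pi_\alpha$. Then, as $\alpha\downarrow0$, $\alpha^{-1/2}\{\theta_\infty^{(\alpha)}-\theta^\star\}$ converges in law to a centered Gaussian vector with covariance matrix $\Sigma$. -/

import Mathlib

open MeasureTheory ProbabilityTheory Filter Topology
open scoped Matrix

noncomputable section

namespace LSA

/-- The state space `ℝ^d` with its Euclidean norm. -/
abbrev Vec (d : ℕ) : Type := EuclideanSpace ℝ (Fin d)

/-- Real `d × d` matrices. -/
abbrev Mat (d : ℕ) : Type := Matrix (Fin d) (Fin d) ℝ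

/-- The Borel (entrywise) σ-algebra on matrices. -/
instance instMeasurableSpaceMat {d : ℕ} : MeasurableSpace (Matrix (Fin d) (Fin d) ℝ) :=
  inferInstanceAs (MeasurableSpace (Fin d → Fin d → ℝ))

/-- The action of a matrix on a vector of `ℝ^d`. -/
def act {d : ℕ} (M : Mat d) (x : Vec d) : Vec d := WithLp.toLp 2 (M *ᵥ x.ofLp)

/-- The spectral norm of a matrix, i.e. its operator norm for the Euclidean norm. -/
def specNorm {d : ℕ} (M : Mat d) : ℝ := ‖Matrix.toEuclideanCLM (𝕜 := ℝ) M‖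

/-- The norm `‖x‖_Q = (xᵀ Q x)^{1/2}`. -/
def vecNormQ {d : ℕ} (Q : Mat d) (x : Vec d) : ℝ := √(x.ofLp ⬝ᵥ (Q *ᵥ x.ofLp))

/-- The operator norm `‖M‖_Q = max {‖M x‖_Q : ‖x‖_Q = 1}`. -/
def opNormQ {d : ℕ} (Q M : Mat d) : ℝ :=
  sSup {r : ℝ | ∃ x : Vec d, vecNormQ Q x = 1 ∧ r = vecNormQ Q (act M x)}

/-- The condition number `λ_max(Q) / λ_min(Q)` of a symmetric positive definite matrix. -/
def condNumber {d : ℕ} (Q : Mat d) : ℝ := sSup (spectrum ℝ Q) / sInf (spectrum ℝ Q)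

/-- A real matrix is Hurwitz if all its complex eigenvalues have negative real part. -/
def IsHurwitz {d : ℕ} (M : Mat d) : Prop :=
  ∀ z : ℂ, Module.End.HasEigenvalue (Matrix.toLin' (M.map (fun r : ℝ => (r : ℂ)))) z → z.re < 0

/-- The (entrywise) expectation of a random matrix. -/
def matMean {d : ℕ} {Ω : Type*} [MeasurableSpace Ω] (P : Measure Ω) (M : Ω → Mat d) : Mat d :=
  Matrix.of fun i j => ∫ ω, M ω i j ∂P

/-- The expectation of a random vector. -/
def vecMean {d : ℕ} {Ω : Type*} [MeasurableSpace Ω] (P : Measure Ω) (v : Ω → Vec d) : Vec d :=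
  ∫ ω, v ω ∂P

/-- The noise assumption: `(A n, b n)`, `n ∈ ℕ`, is an i.i.d. sequence of random pairs (the first
term of the sequence has index `0`), `b` is sub-Gaussian around its mean in every direction with
variance factor `Cb ^ 2`, the spectral norm of `A` is almost surely bounded by `CA`, and minus the
mean of `A` is a Hurwitz matrix. -/
structure NoiseAssumption {d : ℕ} {Ω : Type*} [MeasurableSpace Ω] (P : Measure Ω)
    (A : ℕ → Ω → Mat d) (b : ℕ → Ω → Vec d) (CA Cb : ℝ) : Prop where
  measurable_A : ∀ n, Measurable (A n)
  measurable_b : ∀ n, Measurable (b n)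
  indep : iIndepFun (fun n ω => (A n ω, b n ω)) P
  identDistrib : ∀ n, IdentDistrib (fun ω => (A n ω, b n ω)) (fun ω => (A 0 ω, b 0 ω)) P P
  Cb_pos : 0 < Cb
  subGaussian : ∀ u : Vec d, ‖u‖ = 1 →
    HasSubgaussianMGF (fun ω => inner ℝ u (b 0 ω - vecMean P (b 0))) (Cb ^ 2).toNNReal P
  CA_pos : 0 < CA
  bounded : ∀ᵐ ω ∂P, specNorm (A 0 ω) ≤ CA
  hurwitz : IsHurwitz (-matMean P (A 0))

/-- One step `θ ↦ θ - α (M θ - c)` of the recursion with step size `α` and data `(M, c)`. -/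
def step {d : ℕ} (α : ℝ) (p : Vec d × (Mat d × Vec d)) : Vec d :=
  p.1 - α • (act p.2.1 p.1 - p.2.2)

lemma measurable_step {d : ℕ} (α : ℝ) : Measurable (step (d := d) α) := by
  unfold step act
  refine measurable_fst.sub (Measurable.const_smul (Measurable.sub ?_ ?_) α)
  · refine (WithLp.measurable_toLp 2 _).comp (measurable_pi_lambda _ fun i => ?_)
    simp only [Matrix.mulVec, dotProduct]
    refine Finset.measurable_sum _ fun j _ => Measurable.mul ?_ ?_
    · exact (measurable_pi_apply j).comp ((measurable_pi_apply i).comp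
        (measurable_fst.comp measurable_snd))
    · exact (measurable_pi_apply j).comp ((WithLp.measurable_ofLp 2 _).comp measurable_fst)
  · exact measurable_snd.comp measurable_snd

/-- The Markov kernel of the chain `θ_{n+1} = θ_n - α (A_{n+1} θ_n - b_{n+1})` when the i.i.d. pairs
`(A_n, b_n)` have law `ν`: it sends `θ` to the law of `θ - α (M θ - c)`, where `(M, c) ∼ ν`. -/
def kernel {d : ℕ} (ν : Measure (Mat d × Vec d)) (α : ℝ) : Kernel (Vec d) (Vec d) :=
  (Kernel.id ×ₖ Kernel.const (Vec d) ν).map (step α)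

lemma kernel_apply {d : ℕ} (ν : Measure (Mat d × Vec d)) [SFinite ν] (α : ℝ) (θ : Vec d) :
    kernel ν α θ = ν.map fun p => θ - α • (act p.1 θ - p.2) := by
  rw [kernel, Kernel.map_apply _ (measurable_step α), Kernel.prod_apply, Kernel.id_apply,
    Kernel.const_apply, Measure.dirac_prod, Measure.map_map (measurable_step α) (by fun_prop)]
  rfl

/-- `π` is a stationary distribution of the chain with step size `α` and data distributed as the
first pair `(A 0, b 0)` of the sequence. -/
def IsStationary {d : ℕ} {Ω : Type*} [MeasurableSpace Ω] (P : Measure Ω)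
    (A : ℕ → Ω → Mat d) (b : ℕ → Ω → Vec d) (α : ℝ) (π : Measure (Vec d)) : Prop :=
  IsProbabilityMeasure π ∧ (kernel (P.map fun ω => (A 0 ω, b 0 ω)) α).Invariant π

/-- The noise `ε = b - b̄ - (A - Ā) θ*` of the first step. -/
def noise {d : ℕ} {Ω : Type*} [MeasurableSpace Ω] (P : Measure Ω)
    (A : ℕ → Ω → Mat d) (b : ℕ → Ω → Vec d) (θstar : Vec d) (ω : Ω) : Vec d :=
  b 0 ω - vecMean P (b 0) - act (A 0 ω - matMean P (A 0)) θstar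

/-- The matrix `Σ_ε = E[ε εᵀ]`. -/
def noiseCov {d : ℕ} {Ω : Type*} [MeasurableSpace Ω] (P : Measure Ω)
    (A : ℕ → Ω → Mat d) (b : ℕ → Ω → Vec d) (θstar : Vec d) : Mat d :=
  matMean P fun ω =>
    Matrix.vecMulVec (noise P A b θstar ω).ofLp (noise P A b θstar ω).ofLp

/-- `a = ‖Q‖⁻¹ / 2`. -/
def rate {d : ℕ} (Q : Mat d) : ℝ := (specNorm Q)⁻¹ / 2

/-- `α_∞ = (1/2) ‖Ā‖_Q⁻² ‖Q‖⁻¹`. -/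
def alphaInf {d : ℕ} (Abar Q : Mat d) : ℝ :=
  (1 / 2) * (opNormQ Q Abar ^ 2)⁻¹ * (specNorm Q)⁻¹

/-- `b_Q = 2 √κ_Q C_A`. -/
def bQ {d : ℕ} (Q : Mat d) (CA : ℝ) : ℝ := 2 * √(condNumber Q) * CA

/-- The step size threshold `α_{p,∞} = α_∞ ∧ a / (2 b_Q² (p - 1))`. -/
def alphaMax {d : ℕ} (Abar Q : Mat d) (CA p : ℝ) : ℝ :=
  min (alphaInf Abar Q) (rate Q / (2 * bQ Q CA ^ 2 * (p - 1)))

end LSA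

end

/-! Put s = √α, y = s⁻¹(θ − θ*), and let F be the characteristic function of y under the stationary
law. One step of the chain sends y to y + sε − s²Ay. Expanding the exponential and using
stationarity gives F(t) = (1 − s²σ(t)/2) F(t − s²Āᵀt) + O(s³), where σ(t) = E⟨ε,t⟩². The Gaussian
G(t) = exp(−⟨Σt,t⟩/2) obeys the same recursion up to O(s⁴), because the Lyapunov equation of Σ says
2⟨Σt, Āᵀt⟩ = σ(t). For small s the factor 1 − s²σ/2 has modulus at most one on a bounded set of
frequencies, so D = |F − G| satisfies D(t) ≤ D(t − s²Āᵀt) + O(s³)‖t‖. The map t ↦ t − s²Āᵀt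
contracts a quadratic norm by a factor 1 − cs², and D vanishes linearly at 0. The errors sum to a
geometric series, D(t) = O(s³/s²) = O(s), and Lévy's continuity theorem concludes. The recursion is
`CenteredNoise.norm_errorCharFun_sub_le`, its Gaussian counterpart
`CenteredNoise.abs_exp_form_sub_le`, the summation `le_of_contracting_recursion`, the outcome
`CenteredNoise.exists_norm_errorCharFun_sub_exp_le`.

The remainder is uniform in s because E‖ε‖³ is finite and E‖y‖² stays bounded. The latter follows
from the drift of x ↦ ⟨Qx,x⟩ (`CenteredNoise.form_increment_le`). The same drift without noise shows
that two copies of the chain driven by the same data approach each other. The Markov operator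
therefore contracts Lipschitz constants, which gives uniqueness of the stationary law and, with
tightness, existence.

The solutions Q and Σ come from the Cayley transform, which turns a Lyapunov equation into a
discrete one for a matrix whose powers tend to zero. -/

noncomputable section

namespace LSA

/-! ### Stable matrices and Lyapunov equations. -/

section PowTendsto

attribute [local instance] Matrix.linftyOpNormedRing Matrix.linftyOpNormedAlgebra

/-- Gelfand's formula: the spectral radius is below some r < 1, so eventually ‖C^k‖ ≤ r^k. The
choice of Banach algebra norm is immaterial. -/
lemma tendsto_pow_mulVec_complex {n : Type*} [Fintype n] [DecidableEq n] (C : Matrix n n ℂ)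
    (hC : ∀ z : ℂ, Module.End.HasEigenvalue (Matrix.toLin' C) z → ‖z‖ < 1) (v : n → ℂ) :
    Tendsto (fun k : ℕ => (C ^ k) *ᵥ v) atTop (𝓝 0) := by
  have : CompleteSpace (Matrix n n ℂ) := FiniteDimensional.complete ℂ _
  rcases isEmpty_or_nonempty n with hn | hn
  · refine tendsto_const_nhds.congr fun k => Subsingleton.elim _ _
  have hr : spectralRadius ℂ C < 1 := by
    have := spectrum.spectralRadius_lt_of_forall_lt (r := 1) C fun z hz => ?_
    · simpa using this
    · have := hC z (by
        rw [Module.End.hasEigenvalue_iff_mem_spectrum, Matrix.spectrum_toLin']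
        exact hz)
      exact_mod_cast this
  obtain ⟨r, hr0, hr1⟩ := exists_between hr
  have hev : ∀ᶠ k : ℕ in atTop, (‖C ^ k‖₊ : ENNReal) ≤ r ^ k := by
    filter_upwards [(spectrum.pow_nnnorm_pow_one_div_tendsto_nhds_spectralRadius C).eventually
      (gt_mem_nhds hr0), eventually_gt_atTop 0] with k hk hk0
    have h := ENNReal.rpow_le_rpow hk.le (Nat.cast_nonneg (α := ℝ) k)
    rw [← ENNReal.rpow_mul, one_div_mul_cancel (by positivity), ENNReal.rpow_one,
      ENNReal.rpow_natCast] at h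
    exact h
  have hnorm : Tendsto (fun k : ℕ => ‖C ^ k‖) atTop (𝓝 0) := by
    have h0 : Tendsto (fun k : ℕ => (‖C ^ k‖₊ : ENNReal)) atTop (𝓝 0) :=
      tendsto_of_tendsto_of_tendsto_of_le_of_le' tendsto_const_nhds
        (ENNReal.tendsto_pow_atTop_nhds_zero_of_lt_one hr1) (by simp) hev
    have h1 := (ENNReal.tendsto_toReal ENNReal.zero_ne_top).comp h0
    simpa [Function.comp_def] using h1
  rw [tendsto_zero_iff_norm_tendsto_zero]
  refine squeeze_zero (fun _ => norm_nonneg _) (fun k => Matrix.linfty_opNorm_mulVec _ _) ?_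
  simpa using hnorm.mul_const ‖v‖

end PowTendsto

lemma tendsto_pow_mulVec_real {n : Type*} [Fintype n] [DecidableEq n] (C : Matrix n n ℝ)
    (hC : ∀ z : ℂ, Module.End.HasEigenvalue
      (Matrix.toLin' (C.map (fun r : ℝ => (r : ℂ)))) z → ‖z‖ < 1) (v : n → ℝ) :
    Tendsto (fun k : ℕ => (C ^ k) *ᵥ v) atTop (𝓝 0) := by
  have h := tendsto_pow_mulVec_complex _ hC (fun i => (v i : ℂ))
  rw [tendsto_pi_nhds] at h ⊢
  intro i
  have h2 := (Complex.continuous_re.tendsto _).comp (h i)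
  simp only [Pi.zero_apply, Complex.zero_re] at h2
  refine h2.congr fun k => ?_
  have : (C.map (fun r : ℝ => (r : ℂ))) ^ k = (C ^ k).map (fun r : ℝ => (r : ℂ)) := by
    exact (map_pow (Complex.ofRealHom.mapMatrix (m := n)) C k).symm
  simp only [Function.comp, this, Matrix.mulVec, dotProduct, Matrix.map_apply, Complex.re_sum,
    ← Complex.ofReal_mul, Complex.ofReal_re]

/-- All complex eigenvalues of the real matrix `B` have positive real part. -/
def IsPositiveStable {d : ℕ} (B : Mat d) : Prop :=
  ∀ z : ℂ, Module.End.HasEigenvalue (Matrix.toLin' (B.map (fun r : ℝ => (r : ℂ)))) z → 0 < z.re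

lemma hasEigenvalue_iff_exists_mulVec {n : Type*} [Fintype n] [DecidableEq n]
    (M : Matrix n n ℂ) (z : ℂ) :
    Module.End.HasEigenvalue (Matrix.toLin' M) z ↔ ∃ v ≠ 0, M *ᵥ v = z • v := by
  constructor
  · intro h
    obtain ⟨v, hv⟩ := h.exists_hasEigenvector
    exact ⟨v, hv.2, by simpa using hv.apply_eq_smul⟩
  · rintro ⟨v, hv, h⟩
    exact Module.End.hasEigenvalue_of_hasEigenvector (x := v)
      ⟨Module.End.mem_eigenspace_iff.2 (by simpa using h), hv⟩

variable {d : ℕ} {B : Mat d}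

lemma IsHurwitz.isPositiveStable (h : IsHurwitz (-B)) : IsPositiveStable B := by
  intro z hz
  have := h (-z) ?_
  · simpa using this
  · rw [hasEigenvalue_iff_exists_mulVec] at hz ⊢
    obtain ⟨v, hv, h⟩ := hz
    refine ⟨v, hv, ?_⟩
    rw [neg_smul, ← h, ← Matrix.neg_mulVec]
    congr 1
    ext i j
    simp

lemma IsPositiveStable.transpose (h : IsPositiveStable B) : IsPositiveStable Bᵀ := by
  intro z hz
  refine h z ?_
  rw [Module.End.hasEigenvalue_iff_isRoot_charpoly, Matrix.charpoly_toLin'] at hz ⊢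
  rwa [show Bᵀ.map (fun r : ℝ => (r : ℂ)) = (B.map (fun r : ℝ => (r : ℂ)))ᵀ from rfl,
    Matrix.charpoly_transpose] at hz

lemma map_ofReal_mulVec (M : Mat d) (v : Fin d → ℝ) :
    M.map (fun r : ℝ => (r : ℂ)) *ᵥ (fun i => (v i : ℂ)) = fun i => ((M *ᵥ v) i : ℂ) := by
  ext i
  simp [Matrix.mulVec, dotProduct]

lemma IsPositiveStable.mulVec_ne (h : IsPositiveStable B) {c : ℝ} (hc : c ≤ 0)
    {v : Fin d → ℝ} (hv : v ≠ 0) : B *ᵥ v ≠ c • v := by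
  intro hB
  have := h c ((hasEigenvalue_iff_exists_mulVec _ _).2 ⟨fun i => (v i : ℂ), ?_, ?_⟩)
  · simp at this
    linarith
  · intro h0
    apply hv
    ext i
    simpa using congrFun h0 i
  · rw [map_ofReal_mulVec, hB]
    ext i
    simp

lemma IsPositiveStable.isUnit_det (h : IsPositiveStable B) : IsUnit B.det := by
  rw [isUnit_iff_ne_zero]
  intro h0
  obtain ⟨v, hv, h1⟩ := Matrix.exists_mulVec_eq_zero_iff.2 h0
  exact h.mulVec_ne le_rfl hv (by simpa using h1)

lemma IsPositiveStable.isUnit_det_one_add (h : IsPositiveStable B) : IsUnit (1 + B).det := by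
  rw [isUnit_iff_ne_zero]
  intro h0
  obtain ⟨v, hv, h1⟩ := Matrix.exists_mulVec_eq_zero_iff.2 h0
  refine h.mulVec_ne (c := -1) (by norm_num) hv ?_
  rw [Matrix.add_mulVec, Matrix.one_mulVec] at h1
  simpa using (neg_eq_of_add_eq_zero_right h1).symm

/-- The Cayley transform `(1 + B)⁻¹ (1 - B)`. -/
def cayley (B : Mat d) : Mat d := (1 + B)⁻¹ * (1 - B)

lemma IsPositiveStable.one_add_mul_cayley (h : IsPositiveStable B) :
    (1 + B) * cayley B = 1 - B := by
  rw [cayley, Matrix.mul_nonsing_inv_cancel_left _ _ h.isUnit_det_one_add]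

/-- The Möbius map z ↦ (1 − z)/(1 + z) is an involution exchanging the right half-plane and the unit
disc. An eigenvalue z of the Cayley transform yields the eigenvalue (1 − z)/(1 + z) of `B`, whose
real part has the sign of 1 − |z|². -/
lemma IsPositiveStable.tendsto_cayley_pow (h : IsPositiveStable B) (v : Fin d → ℝ) :
    Tendsto (fun k : ℕ => (cayley B ^ k) *ᵥ v) atTop (𝓝 0) := by
  refine tendsto_pow_mulVec_real _ (fun z hz => ?_) v
  obtain ⟨w, hw, hwz⟩ := (hasEigenvalue_iff_exists_mulVec _ _).1 hz
  set Bc : Matrix (Fin d) (Fin d) ℂ := B.map (fun r : ℝ => (r : ℂ)) with hBc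
  have hmul : (1 + Bc) * (cayley B).map (fun r : ℝ => (r : ℂ)) = 1 - Bc := by
    have := congrArg (Complex.ofRealHom.mapMatrix (m := Fin d)) h.one_add_mul_cayley
    rw [map_mul, map_add, map_sub, map_one] at this
    exact this
  have h1 : (1 - Bc) *ᵥ w = z • ((1 + Bc) *ᵥ w) := by
    rw [← hmul, ← Matrix.mulVec_mulVec, hwz, Matrix.mulVec_smul]
  have h2 : (1 + z) • (Bc *ᵥ w) = (1 - z) • w := by
    rw [Matrix.sub_mulVec, Matrix.add_mulVec, Matrix.one_mulVec, smul_add] at h1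
    rw [add_smul, sub_smul, one_smul, one_smul, eq_sub_iff_add_eq, add_assoc, add_comm (z • _),
      ← h1]
    abel
  have hz1 : 1 + z ≠ 0 := by
    intro h0
    rw [h0, zero_smul] at h2
    have : 1 - z = 2 := by linear_combination -h0
    rw [this] at h2
    exact hw ((smul_eq_zero.1 h2.symm).resolve_left two_ne_zero)
  have h3 : 0 < ((1 - z) / (1 + z)).re := by
    refine h _ ((hasEigenvalue_iff_exists_mulVec _ _).2 ⟨w, hw, ?_⟩)
    rw [div_eq_inv_mul, mul_smul, ← h2, smul_smul, inv_mul_cancel₀ hz1, one_smul]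
  rw [Complex.div_re, ← add_div] at h3
  have h4 := (div_pos_iff_of_pos_right (Complex.normSq_pos.2 hz1)).1 h3
  simp at h4
  have h5 : ‖z‖ ^ 2 < 1 := by
    rw [← Complex.normSq_eq_norm_sq, Complex.normSq_apply]
    linarith
  have := norm_nonneg z
  nlinarith

/-- Since (1 + B) times the Cayley transform is 1 − B, this is the identity (1 + B)ᵀX(1 + B) − (1 −
B)ᵀX(1 − B) = 2(BᵀX + XB). It turns the Lyapunov equation into Y = CᵀYC + 2N, which can be iterated.
-/
lemma IsPositiveStable.lyapunov_step (h : IsPositiveStable B) {X N : Mat d}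
    (hX : Bᵀ * X + X * B = N) :
    (1 + B)ᵀ * X * (1 + B) =
      (cayley B)ᵀ * ((1 + B)ᵀ * X * (1 + B)) * cayley B + (2 : ℝ) • N := by
  have e : (cayley B)ᵀ * ((1 + B)ᵀ * X * (1 + B)) * cayley B
      = ((1 + B) * cayley B)ᵀ * X * ((1 + B) * cayley B) := by
    rw [Matrix.transpose_mul]; noncomm_ring
  rw [e, h.one_add_mul_cayley, ← hX]
  simp only [Matrix.transpose_add, Matrix.transpose_sub, Matrix.transpose_one, two_smul]
  noncomm_ring

lemma dotProduct_transpose_mul_mul (C Y : Mat d) (x y : Fin d → ℝ) :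
    x ⬝ᵥ ((Cᵀ * Y * C) *ᵥ y) = (C *ᵥ x) ⬝ᵥ (Y *ᵥ (C *ᵥ y)) := by
  rw [← Matrix.mulVec_mulVec, ← Matrix.mulVec_mulVec, Matrix.dotProduct_mulVec,
    Matrix.vecMul_transpose]

lemma continuous_dotProduct_mulVec (Y : Mat d) :
    Continuous fun p : (Fin d → ℝ) × (Fin d → ℝ) => p.1 ⬝ᵥ (Y *ᵥ p.2) := by
  simp only [dotProduct, Matrix.mulVec]
  fun_prop

lemma IsPositiveStable.tendsto_form (h : IsPositiveStable B) (Y : Mat d) (x y : Fin d → ℝ) :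
    Tendsto (fun k : ℕ => ((cayley B ^ k) *ᵥ x) ⬝ᵥ (Y *ᵥ ((cayley B ^ k) *ᵥ y))) atTop (𝓝 0) := by
  have := ((continuous_dotProduct_mulVec Y).tendsto (0, 0)).comp
    ((h.tendsto_cayley_pow x).prodMk_nhds (h.tendsto_cayley_pow y))
  simpa only [Function.comp_def, Matrix.mulVec_zero, dotProduct_zero] using this

/-- The bilinear form of Y is invariant under the Cayley transform, whose powers tend to zero, so it
vanishes; then 1 + B is cancelled on both sides. -/
lemma IsPositiveStable.lyapunov_injective (h : IsPositiveStable B) {X : Mat d}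
    (hX : Bᵀ * X + X * B = 0) : X = 0 := by
  set Y := (1 + B)ᵀ * X * (1 + B) with hY
  have hs : Y = (cayley B)ᵀ * Y * cayley B := by
    have := h.lyapunov_step hX
    rwa [smul_zero, add_zero] at this
  have hxy : ∀ x y, x ⬝ᵥ (Y *ᵥ y) = 0 := by
    intro x y
    refine tendsto_nhds_unique (tendsto_const_nhds (x := x ⬝ᵥ (Y *ᵥ y)) (f := atTop))
      ((h.tendsto_form Y x y).congr fun k => ?_)
    induction k with
    | zero => simp
    | succ k ih =>
      rw [← ih]
      conv_rhs => rw [hs, dotProduct_transpose_mul_mul]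
      simp only [Matrix.mulVec_mulVec, ← pow_succ']
  have hY0 : Y = 0 := by
    ext i j
    have := hxy (Pi.single i 1) (Pi.single j 1)
    simpa using this
  have hu := h.isUnit_det_one_add
  have h1 : (1 + B)ᵀ * X = 0 := by
    have := congrArg (· * (1 + B)⁻¹) hY0
    simpa [hY, Matrix.mul_assoc, Matrix.mul_nonsing_inv _ hu] using this
  have hut : IsUnit (1 + B)ᵀ.det := by rwa [Matrix.det_transpose]
  rw [← Matrix.nonsing_inv_mul_cancel_left (1 + B)ᵀ X hut, h1, Matrix.mul_zero]

/-- The form of Y decreases to 0 along the powers of the Cayley transform, hence is nonnegative; its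
first decrement is already 2⟨Nx,x⟩. As 1 + B is onto, both semidefiniteness and definiteness pass
from N to X. -/
lemma IsPositiveStable.two_mul_le_form (h : IsPositiveStable B) {X N : Mat d}
    (hX : Bᵀ * X + X * B = N) (hN : ∀ x, 0 ≤ x ⬝ᵥ (N *ᵥ x)) (x : Fin d → ℝ) :
    2 * (x ⬝ᵥ (N *ᵥ x)) ≤ ((1 + B) *ᵥ x) ⬝ᵥ (X *ᵥ ((1 + B) *ᵥ x)) := by
  set Y := (1 + B)ᵀ * X * (1 + B) with hY
  rw [← dotProduct_transpose_mul_mul, ← hY]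
  have hs : ∀ x, x ⬝ᵥ (Y *ᵥ x) =
      (cayley B *ᵥ x) ⬝ᵥ (Y *ᵥ (cayley B *ᵥ x)) + 2 * (x ⬝ᵥ (N *ᵥ x)) := by
    intro x
    conv_lhs => rw [hY, h.lyapunov_step hX, ← hY, Matrix.add_mulVec, dotProduct_add,
      dotProduct_transpose_mul_mul, Matrix.smul_mulVec, dotProduct_smul, smul_eq_mul]
  have hle : ∀ x, 0 ≤ x ⬝ᵥ (Y *ᵥ x) := by
    intro x
    refine le_of_tendsto' (h.tendsto_form Y x x) fun k => ?_
    induction k with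
    | zero => simp
    | succ k ih =>
      refine le_trans ?_ ih
      rw [hs (cayley B ^ k *ᵥ x)]
      have := hN ((cayley B ^ k) *ᵥ x)
      rw [pow_succ', ← Matrix.mulVec_mulVec]
      linarith
  have := hle (cayley B *ᵥ x)
  rw [hs x]
  linarith

lemma IsPositiveStable.exists_eq_one_add_mulVec (h : IsPositiveStable B) (x : Fin d → ℝ) :
    ∃ z, x = (1 + B) *ᵥ z :=
  ⟨(1 + B)⁻¹ *ᵥ x, by
    rw [Matrix.mulVec_mulVec, Matrix.mul_nonsing_inv _ h.isUnit_det_one_add, Matrix.one_mulVec]⟩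

/-- The Lyapunov operator `X ↦ Bᵀ X + X B`. -/
def lyapunovMap (B : Mat d) : Mat d →ₗ[ℝ] Mat d where
  toFun X := Bᵀ * X + X * B
  map_add' X Y := by noncomm_ring
  map_smul' c X := by simp

lemma IsPositiveStable.lyapunovMap_bijective (h : IsPositiveStable B) :
    Function.Bijective (lyapunovMap B) := by
  have hi : Function.Injective (lyapunovMap B) :=
    (injective_iff_map_eq_zero _).2 fun X hX => h.lyapunov_injective hX
  exact ⟨hi, LinearMap.injective_iff_surjective.1 hi⟩

lemma IsPositiveStable.existsUnique_lyapunov (h : IsPositiveStable B) (N : Mat d) :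
    ∃! X, Bᵀ * X + X * B = N :=
  h.lyapunovMap_bijective.existsUnique N

lemma IsPositiveStable.lyapunov_isSymm (h : IsPositiveStable B) {X N : Mat d}
    (hX : Bᵀ * X + X * B = N) (hN : Nᵀ = N) : Xᵀ = X := by
  refine (h.existsUnique_lyapunov N).unique ?_ hX
  rw [← hN, ← hX]
  simp [add_comm]

lemma IsPositiveStable.lyapunov_posSemidef (h : IsPositiveStable B) {X N : Mat d}
    (hX : Bᵀ * X + X * B = N) (hN : N.PosSemidef) : X.PosSemidef := by
  have hq : ∀ x, 0 ≤ x ⬝ᵥ (N *ᵥ x) := fun x => by simpa using hN.dotProduct_mulVec_nonneg x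
  refine Matrix.PosSemidef.of_dotProduct_mulVec_nonneg ?_ fun x => ?_
  · have := h.lyapunov_isSymm hX (by simpa [Matrix.IsHermitian] using hN.1)
    simpa [Matrix.IsHermitian] using this
  · obtain ⟨z, rfl⟩ := h.exists_eq_one_add_mulVec x
    have := h.two_mul_le_form hX hq z
    have := hq z
    simp only [star_trivial]
    linarith

lemma IsPositiveStable.lyapunov_posDef (h : IsPositiveStable B) {X N : Mat d}
    (hX : Bᵀ * X + X * B = N) (hN : N.PosDef) : X.PosDef := by
  refine Matrix.PosDef.of_dotProduct_mulVec_pos (h.lyapunov_posSemidef hX hN.posSemidef).1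
    fun x hx => ?_
  obtain ⟨z, rfl⟩ := h.exists_eq_one_add_mulVec x
  have hz : z ≠ 0 := by
    rintro rfl
    simp at hx
  have h1 := h.two_mul_le_form hX
    (fun x => by simpa using hN.posSemidef.dotProduct_mulVec_nonneg x) z
  have h2 := hN.dotProduct_mulVec_pos hz
  simp only [star_trivial] at h2 ⊢
  linarith

/-! ### Invariant laws of Markov kernels that contract Lipschitz constants. -/

section ContractiveKernel

variable {E : Type*} [NormedAddCommGroup E] [MeasurableSpace E] [BorelSpace E]

/-- Functions bounded by one that are Lipschitz with constant `L` for the gauge `N`. -/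
structure GaugeLipschitz (N : E → ℝ) (L : ℝ) (f : E → ℂ) : Prop where
  norm_le_one : ∀ x, ‖f x‖ ≤ 1
  norm_sub_le : ∀ x y, ‖f x - f y‖ ≤ L * N (x - y)

variable {N : E → ℝ} {L : ℝ} {f : E → ℂ}

lemma GaugeLipschitz.continuous (hf : GaugeLipschitz N L f) (hN : Continuous N) (hN0 : N 0 = 0) :
    Continuous f := by
  rw [continuous_iff_continuousAt]
  intro x
  rw [ContinuousAt, tendsto_iff_norm_sub_tendsto_zero]
  refine squeeze_zero (fun _ => norm_nonneg _) (fun y => hf.norm_sub_le y x) ?_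
  have : Continuous fun y => L * N (y - x) := by fun_prop
  simpa [hN0] using this.tendsto x

lemma GaugeLipschitz.integrable (hf : GaugeLipschitz N L f) (hN : Continuous N) (hN0 : N 0 = 0)
    (ρ : Measure E) [IsFiniteMeasure ρ] : Integrable f ρ := by
  refine Integrable.of_bound ?_ 1 (.of_forall hf.norm_le_one)
  exact (hf.continuous hN hN0).measurable.aestronglyMeasurable

/-- The Markov operator `f ↦ ∫ f dκ(x, ·)`. -/
def markovOp (κ : Kernel E E) (f : E → ℂ) (x : E) : ℂ := ∫ y, f y ∂(κ x)

/-- The gauge `N` is contracted by the Markov operator of `κ` by the factor `r`. -/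
def IsGaugeContraction (κ : Kernel E E) (N : E → ℝ) (r : ℝ) : Prop :=
  ∀ (L : ℝ) (f : E → ℂ), 0 ≤ L → GaugeLipschitz N L f → GaugeLipschitz N (r * L) (markovOp κ f)

variable {κ : Kernel E E} {r : ℝ}

lemma IsGaugeContraction.iterate (h : IsGaugeContraction κ N r) (hr : 0 ≤ r) (hL : 0 ≤ L)
    (hf : GaugeLipschitz N L f) (n : ℕ) :
    GaugeLipschitz N (r ^ n * L) ((markovOp κ)^[n] f) := by
  induction n with
  | zero => simpa using hf
  | succ n ih =>
    rw [Function.iterate_succ_apply', pow_succ', mul_assoc]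
    exact h _ _ (by positivity) ih

/-- The iterates flatten to constants at the rate rⁿ. Being bounded by one they converge
dominatedly, so `ρ` needs no moment. -/
lemma IsGaugeContraction.tendsto_integral_sub (h : IsGaugeContraction κ N r) (hr : 0 ≤ r)
    (hr1 : r < 1) (hL : 0 ≤ L) (hf : GaugeLipschitz N L f) (hN : Continuous N) (hN0 : N 0 = 0)
    (ρ : Measure E) [IsProbabilityMeasure ρ] :
    Tendsto (fun n => ∫ x, (markovOp κ)^[n] f x ∂ρ - (markovOp κ)^[n] f 0) atTop (𝓝 0) := by
  have hit := h.iterate hr hL hf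
  have h1 : ∀ n, ∫ x, (markovOp κ)^[n] f x ∂ρ - (markovOp κ)^[n] f 0
      = ∫ x, ((markovOp κ)^[n] f x - (markovOp κ)^[n] f 0) ∂ρ := by
    intro n
    rw [integral_sub ((hit n).integrable hN hN0 ρ) (integrable_const _)]
    simp
  simp_rw [h1]
  rw [← integral_zero E ℂ (μ := ρ)]
  refine tendsto_integral_of_dominated_convergence (fun _ => 2) (fun n => ?_)
    (integrable_const _) (fun n => .of_forall fun x => ?_) (.of_forall fun x => ?_)
  · exact (((hit n).integrable hN hN0 ρ).sub (integrable_const _)).1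
  · calc _ ≤ _ := norm_sub_le _ _
      _ ≤ 1 + 1 := add_le_add ((hit n).norm_le_one _) ((hit n).norm_le_one _)
      _ = 2 := by norm_num
  · rw [tendsto_zero_iff_norm_tendsto_zero]
    refine squeeze_zero (fun _ => norm_nonneg _) (fun n => (hit n).norm_sub_le x 0) ?_
    have := ((tendsto_pow_atTop_nhds_zero_of_lt_one hr hr1).mul_const L).mul_const (N (x - 0))
    simpa using this

lemma integral_bind_eq_integral_markovOp [IsMarkovKernel κ] {ρ : Measure E}
    [IsProbabilityMeasure ρ] (hf : GaugeLipschitz N L f) (hN : Continuous N) (hN0 : N 0 = 0) :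
    ∫ x, f x ∂(ρ.bind κ) = ∫ x, markovOp κ f x ∂ρ := by
  have hi := hf.integrable hN hN0 (ρ.bind κ)
  rw [Measure.comp_eq_comp_const_apply] at hi ⊢
  rw [Kernel.integral_comp hi]
  simp [markovOp]

/-- The law after `n` steps of the chain with kernel `κ` started from `ρ`. -/
def chainLaw (κ : Kernel E E) (ρ : Measure E) : ℕ → Measure E
  | 0 => ρ
  | n + 1 => (chainLaw κ ρ n).bind κ

instance instIsProbabilityMeasureChainLaw [IsMarkovKernel κ] (ρ : Measure E)
    [IsProbabilityMeasure ρ] (n : ℕ) : IsProbabilityMeasure (chainLaw κ ρ n) := by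
  induction n with
  | zero => exact ‹_›
  | succ n ih => exact inferInstanceAs (IsProbabilityMeasure ((chainLaw κ ρ n).bind κ))

lemma IsGaugeContraction.integral_chainLaw [IsMarkovKernel κ] (h : IsGaugeContraction κ N r)
    (hr : 0 ≤ r) (hL : 0 ≤ L) (hf : GaugeLipschitz N L f) (hN : Continuous N) (hN0 : N 0 = 0)
    (ρ : Measure E) [IsProbabilityMeasure ρ] (n : ℕ) :
    ∫ x, f x ∂(chainLaw κ ρ n) = ∫ x, (markovOp κ)^[n] f x ∂ρ := by
  induction n generalizing L f with
  | zero => rfl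
  | succ n ih =>
    rw [chainLaw, integral_bind_eq_integral_markovOp hf hN hN0, Function.iterate_succ_apply]
    exact ih (by positivity) (h _ _ hL hf)

lemma IsGaugeContraction.tendsto_integral_chainLaw_sub [IsMarkovKernel κ]
    (h : IsGaugeContraction κ N r) (hr : 0 ≤ r) (hr1 : r < 1) (hL : 0 ≤ L)
    (hf : GaugeLipschitz N L f) (hN : Continuous N) (hN0 : N 0 = 0)
    (ρ ρ' : Measure E) [IsProbabilityMeasure ρ] [IsProbabilityMeasure ρ'] :
    Tendsto (fun n => ∫ x, f x ∂(chainLaw κ ρ n) - ∫ x, f x ∂(chainLaw κ ρ' n)) atTop (𝓝 0) := by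
  simp_rw [h.integral_chainLaw hr hL hf hN hN0]
  have := (h.tendsto_integral_sub hr hr1 hL hf hN hN0 ρ).sub
    (h.tendsto_integral_sub hr hr1 hL hf hN hN0 ρ')
  simpa using this

lemma chainLaw_of_invariant {π : Measure E} (hπ : κ.Invariant π) (n : ℕ) :
    chainLaw κ π n = π := by
  induction n with
  | zero => rfl
  | succ n ih => rw [chainLaw, ih]; exact hπ

lemma chainLaw_bind (ρ : Measure E) (n : ℕ) :
    chainLaw κ (ρ.bind κ) n = chainLaw κ ρ (n + 1) := by
  induction n with
  | zero => rfl
  | succ n ih => rw [chainLaw, ih, ← chainLaw]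

lemma norm_exp_mul_I_sub_le (a b : ℝ) :
    ‖Complex.exp (a * Complex.I) - Complex.exp (b * Complex.I)‖ ≤ |a - b| := by
  have : Complex.exp (a * Complex.I) - Complex.exp (b * Complex.I)
      = Complex.exp (b * Complex.I) * (Complex.exp (Complex.I * ((a - b : ℝ) : ℂ)) - 1) := by
    rw [mul_sub, ← Complex.exp_add, mul_one]
    congr 2
    push_cast
    ring
  rw [this, norm_mul, Complex.norm_exp_ofReal_mul_I, one_mul]
  simpa using Real.norm_exp_I_mul_ofReal_sub_one_le (x := a - b)

variable [InnerProductSpace ℝ E]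

lemma gaugeLipschitz_exp_inner {c : ℝ} (hc : ∀ x, ‖x‖ ≤ c * N x) (t : E) :
    GaugeLipschitz N (‖t‖ * c) fun x => Complex.exp ((inner ℝ x t : ℝ) * Complex.I) where
  norm_le_one x := (Complex.norm_exp_ofReal_mul_I _).le
  norm_sub_le x y := by
    refine (norm_exp_mul_I_sub_le _ _).trans ?_
    rw [← inner_sub_left]
    calc |inner ℝ (x - y) t| ≤ ‖x - y‖ * ‖t‖ := abs_real_inner_le_norm _ _
      _ ≤ c * N (x - y) * ‖t‖ := by gcongr; exact hc _
      _ = _ := by ring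

/-- Characters are bounded and gauge-Lipschitz, and they determine a law. Uniqueness thus holds
among all invariant probability measures, not only those with moments. -/
lemma IsGaugeContraction.invariant_unique [CompleteSpace E] [SecondCountableTopology E]
    [IsMarkovKernel κ] (h : IsGaugeContraction κ N r) (hr : 0 ≤ r) (hr1 : r < 1)
    (hN : Continuous N) (hN0 : N 0 = 0) {c : ℝ} (hc0 : 0 ≤ c) (hc : ∀ x, ‖x‖ ≤ c * N x)
    {π π' : Measure E} [IsProbabilityMeasure π] [IsProbabilityMeasure π']
    (hπ : κ.Invariant π) (hπ' : κ.Invariant π') : π = π' := by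
  refine Measure.ext_of_charFun (funext fun t => ?_)
  have := h.tendsto_integral_chainLaw_sub hr hr1 (by positivity) (gaugeLipschitz_exp_inner hc t)
    hN hN0 π π'
  simp_rw [chainLaw_of_invariant hπ, chainLaw_of_invariant hπ'] at this
  exact sub_eq_zero.1 (tendsto_nhds_unique tendsto_const_nhds this)

/-- The drift bounds the mean of `V` along the chain started at `θs`, so its laws are tight. A limit
point is invariant because the laws after n and n + 1 steps become indistinguishable by characters,
by the contraction; no Cesàro averaging is needed. -/
lemma IsGaugeContraction.exists_invariant [FiniteDimensional ℝ E] [IsMarkovKernel κ]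
    (h : IsGaugeContraction κ N r) (hr : 0 ≤ r) (hr1 : r < 1)
    (hN : Continuous N) (hN0 : N 0 = 0) {c : ℝ} (hc0 : 0 ≤ c) (hc : ∀ x, ‖x‖ ≤ c * N x)
    {V : E → ℝ} (hV : Continuous V) {a D : ℝ} {θs : E} (ha : 0 < a)
    (hVlb : ∀ x, a * ‖x - θs‖ ^ 2 ≤ V x) (hV0 : V θs = 0)
    {s : ℝ} (hs : 0 ≤ s) (hs1 : s < 1) (hD : 0 ≤ D)
    (hdrift : ∀ x, ∫⁻ y, ENNReal.ofReal (V y) ∂(κ x) ≤ ENNReal.ofReal (s * V x + D)) :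
    ∃ π : Measure E, IsProbabilityMeasure π ∧ κ.Invariant π ∧
      ∫⁻ x, ENNReal.ofReal (V x) ∂π < ⊤ := by
  have hE : CompleteSpace E := FiniteDimensional.complete ℝ E
  have hE' : ProperSpace E := FiniteDimensional.proper ℝ E
  have hVnn : ∀ x, 0 ≤ V x := fun x => le_trans (by positivity) (hVlb x)
  have hVm : Measurable fun x => ENNReal.ofReal (V x) := by fun_prop
  -- The fixed point of v ↦ sv + D, so the bound is preserved by each step.
  set K : ℝ := D / (1 - s) with hK
  have hs' : 0 < 1 - s := by linarith
  have hK0 : 0 ≤ K := by positivity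
  have hKeq : s * K + D = K := by rw [hK]; field_simp; ring
  let μ : ℕ → ProbabilityMeasure E := fun n => ⟨chainLaw κ (Measure.dirac θs) n, inferInstance⟩
  have hmom : ∀ n, ∫⁻ x, ENNReal.ofReal (V x) ∂(μ n : Measure E) ≤ ENNReal.ofReal K := by
    intro n
    change ∫⁻ x, ENNReal.ofReal (V x) ∂(chainLaw κ (Measure.dirac θs) n) ≤ _
    induction n with
    | zero =>
      rw [chainLaw, lintegral_dirac' _ hVm, hV0]
      simp
    | succ n ih =>
      rw [chainLaw, Measure.lintegral_bind κ.aemeasurable hVm.aemeasurable]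
      calc _ ≤ ∫⁻ x, (ENNReal.ofReal s * ENNReal.ofReal (V x) + ENNReal.ofReal D)
              ∂(chainLaw κ (Measure.dirac θs) n) := by
            refine lintegral_mono fun x => (hdrift x).trans_eq ?_
            rw [← ENNReal.ofReal_mul hs,
              ← ENNReal.ofReal_add (mul_nonneg hs (hVnn x)) hD]
        _ = ENNReal.ofReal s * ∫⁻ x, ENNReal.ofReal (V x) ∂(chainLaw κ (Measure.dirac θs) n)
              + ENNReal.ofReal D := by
            rw [lintegral_add_right _ measurable_const, lintegral_const_mul _ hVm]
            simp
        _ ≤ ENNReal.ofReal s * ENNReal.ofReal K + ENNReal.ofReal D := by gcongr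
        _ = ENNReal.ofReal K := by
            rw [← ENNReal.ofReal_mul hs, ← ENNReal.ofReal_add (by positivity) hD, hKeq]
  have htight : IsTightMeasureSet {((ν : ProbabilityMeasure E) : Measure E) | ν ∈ Set.range μ} := by
    refine isTightMeasureSet_of_tendsto_measure_compl_closedBall (x := θs) ?_
    have hlim : Tendsto (fun R : ℝ => ENNReal.ofReal (K / (a * R ^ 2))) atTop (𝓝 0) := by
      rw [← ENNReal.ofReal_zero]
      refine ENNReal.tendsto_ofReal ?_
      refine Tendsto.const_div_atTop ?_ K
      exact (tendsto_pow_atTop two_ne_zero).const_mul_atTop ha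
    refine tendsto_of_tendsto_of_tendsto_of_le_of_le' tendsto_const_nhds hlim (by simp) ?_
    filter_upwards [eventually_gt_atTop 0] with R hR
    refine iSup₂_le ?_
    rintro _ ⟨_, ⟨n, rfl⟩, rfl⟩
    have hR2 : 0 < a * R ^ 2 := by positivity
    rw [ENNReal.ofReal_div_of_pos hR2, ENNReal.le_div_iff_mul_le (by simp [hR2]) (by simp),
      mul_comm]
    refine le_trans ?_ ((mul_meas_ge_le_lintegral hVm (ENNReal.ofReal (a * R ^ 2))).trans (hmom n))
    gcongr
    intro x hx
    simp only [Set.mem_compl_iff, Metric.mem_closedBall, not_le, dist_eq_norm] at hx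
    refine ENNReal.ofReal_le_ofReal (le_trans ?_ (hVlb x))
    gcongr
  have hcomp := isCompact_closure_of_isTightMeasureSet htight
  -- A limit along a nonprincipal ultrafilter replaces the extraction of a subsequence.
  obtain ⟨μ', -, hμ' : Tendsto μ (hyperfilter ℕ : Filter ℕ) (𝓝 μ')⟩ :=
    hcomp.ultrafilter_le_nhds ((hyperfilter ℕ).map μ)
    (.trans (by simp) (monotone_principal subset_closure))
  have hbc : ∀ f : E → ℂ, ∀ L, GaugeLipschitz N L f →
      Tendsto (fun n => ∫ x, f x ∂(μ n : Measure E)) (hyperfilter ℕ) (𝓝 (∫ x, f x ∂(μ' : Measure E))) := by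
    intro f L hf
    have := (ProbabilityMeasure.tendsto_iff_forall_integral_rclike_tendsto ℂ).1 hμ'
    exact this (BoundedContinuousFunction.ofNormedAddCommGroup f (hf.continuous hN hN0) 1
      hf.norm_le_one)
  refine ⟨μ', inferInstance, ?_, ?_⟩
  · refine Measure.ext_of_charFun (funext fun t => ?_)
    have hf := gaugeLipschitz_exp_inner hc t
    have hL : 0 ≤ ‖t‖ * c := by positivity
    rw [charFun_apply, charFun_apply, integral_bind_eq_integral_markovOp hf hN hN0]
    have h1 := hbc _ _ (h _ _ hL hf)
    have h2 := hbc _ _ hf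
    have h3 : Tendsto (fun n => ∫ x, markovOp κ (fun x => Complex.exp ((inner ℝ x t : ℝ) *
        Complex.I)) x ∂(μ n : Measure E) - ∫ x, Complex.exp ((inner ℝ x t : ℝ) * Complex.I)
        ∂(μ n : Measure E)) (hyperfilter ℕ) (𝓝 0) := by
      refine Tendsto.mono_left ?_ Nat.hyperfilter_le_atTop
      -- Starting from the law after one step shifts time by one, so this compares steps n + 1 and
      -- n.
      refine (h.tendsto_integral_chainLaw_sub hr hr1 hL hf hN hN0 ((Measure.dirac θs).bind κ)
        (Measure.dirac θs)).congr fun n => ?_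
      rw [chainLaw_bind, chainLaw, integral_bind_eq_integral_markovOp hf hN hN0]
      rfl
    exact sub_eq_zero.1 (tendsto_nhds_unique (h1.sub h2) h3)
  -- `V` is unbounded, so weak convergence is applied to its truncations and the truncation is
  -- removed by monotone convergence.
  · have hcut : ∀ R : ℕ, ∫⁻ x, ENNReal.ofReal (min (V x) R) ∂(μ' : Measure E)
        ≤ ENNReal.ofReal K := by
      intro R
      have hcont : Continuous fun x => min (V x) (R : ℝ) := by fun_prop
      let g : BoundedContinuousFunction E NNReal := BoundedContinuousFunction.mkOfBound
        ⟨fun x => Real.toNNReal (min (V x) R), by fun_prop⟩ R (fun x y => by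
          have h0 : ∀ x, ((Real.toNNReal (min (V x) R) : NNReal) : ℝ) ≤ R := fun x => by
            rw [Real.coe_toNNReal _ (le_min (hVnn x) (by positivity))]
            exact min_le_right _ _
          have h1 : ∀ x, (0 : ℝ) ≤ (Real.toNNReal (min (V x) R) : NNReal) := fun x => by positivity
          change dist (Real.toNNReal (min (V x) R)) (Real.toNNReal (min (V y) R)) ≤ R
          rw [NNReal.dist_eq, abs_le]
          constructor <;> linarith [h0 x, h0 y, h1 x, h1 y])
      have := (ProbabilityMeasure.tendsto_iff_forall_lintegral_tendsto.1 hμ') g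
      refine le_of_tendsto' this fun n => le_trans ?_ (hmom n)
      refine lintegral_mono fun x => ?_
      exact ENNReal.ofReal_le_ofReal (min_le_left _ _)
    have hsup : ∀ x, ENNReal.ofReal (V x) = ⨆ R : ℕ, ENNReal.ofReal (min (V x) R) := by
      intro x
      refine le_antisymm ?_ (iSup_le fun R => ENNReal.ofReal_le_ofReal (min_le_left _ _))
      obtain ⟨R, hR⟩ := exists_nat_ge (V x)
      exact le_iSup_of_le R (by rw [min_eq_left hR])
    simp_rw [hsup]
    rw [lintegral_iSup (fun R => by fun_prop)]
    · exact (iSup_le hcut).trans_lt ENNReal.ofReal_lt_top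
    · intro R R' hRR x
      refine ENNReal.ofReal_le_ofReal (min_le_min_left _ ?_)
      exact_mod_cast hRR

end ContractiveKernel

/-! ### Drift, stationary laws and second moments of the linear recursion. -/

section LinearChain

variable {E : Type*} [NormedAddCommGroup E] [InnerProductSpace ℝ E] [FiniteDimensional ℝ E]

/-- `Q` is a symmetric positive operator with `Mᵀ Q + Q M = 1` and spectrum in `[l, u]`. -/
structure IsLyapunov (M Q : E →L[ℝ] E) (l u : ℝ) : Prop where
  pos_l : 0 < l
  pos_u : 0 < u
  symm : ∀ x y, inner ℝ (Q x) y = inner ℝ x (Q y)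
  lower : ∀ x, l * ‖x‖ ^ 2 ≤ inner ℝ (Q x) x
  upper : ∀ x, inner ℝ (Q x) x ≤ u * ‖x‖ ^ 2
  lyapunov : ∀ x, 2 * inner ℝ (Q x) (M x) = ‖x‖ ^ 2

/-- The norm `√⟨Q x, x⟩`. -/
def gauge (Q : E →L[ℝ] E) (x : E) : ℝ := √(inner ℝ (Q x) x)

omit [FiniteDimensional ℝ E] in
lemma continuous_gauge (Q : E →L[ℝ] E) : Continuous (gauge Q) := by
  unfold gauge
  fun_prop

omit [FiniteDimensional ℝ E] in
lemma gauge_zero (Q : E →L[ℝ] E) : gauge Q 0 = 0 := by simp [gauge]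

section

variable {Mbar Q : E →L[ℝ] E} {l u : ℝ}

omit [FiniteDimensional ℝ E]

lemma IsLyapunov.form_nonneg (hQ : IsLyapunov Mbar Q l u) (x : E) : 0 ≤ inner ℝ (Q x) x :=
  le_trans (by have := hQ.pos_l; positivity) (hQ.lower x)

lemma IsLyapunov.norm_le_gauge (hQ : IsLyapunov Mbar Q l u) (x : E) :
    ‖x‖ ≤ (√l)⁻¹ * gauge Q x := by
  have hl := Real.sqrt_pos.2 hQ.pos_l
  rw [inv_mul_eq_div, le_div_iff₀ hl, mul_comm, gauge]
  refine Real.le_sqrt_of_sq_le ?_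
  rw [mul_pow, Real.sq_sqrt hQ.pos_l.le]
  exact hQ.lower x

lemma IsLyapunov.form_add (hQ : IsLyapunov Mbar Q l u) (x w : E) :
    inner ℝ (Q (x + w)) (x + w) = inner ℝ (Q x) x + 2 * inner ℝ (Q x) w + inner ℝ (Q w) w := by
  have : inner ℝ (Q w) x = inner ℝ (Q x) w := by rw [hQ.symm w x, real_inner_comm]
  simp only [map_add, inner_add_left, inner_add_right, this]
  ring

end

variable {Ω : Type*} [MeasurableSpace Ω]
variable [MeasurableSpace E] [BorelSpace E]

/-- A random operator `M`, bounded by `K` and with mean `Mbar`, and a centered random vector `ε`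
with a finite third moment. -/
structure CenteredNoise (P : Measure Ω) (M : Ω → E →L[ℝ] E) (ε : Ω → E) (Mbar : E →L[ℝ] E)
    (K : ℝ) : Prop where
  measurable_apply : ∀ x, Measurable fun ω => M ω x
  measurable_eps : Measurable ε
  bound : ∀ᵐ ω ∂P, ‖M ω‖ ≤ K
  mean : ∀ x u, ∫ ω, inner ℝ u (M ω x) ∂P = inner ℝ u (Mbar x)
  memLp_eps : MemLp ε 3 P
  mean_eps : ∀ u, ∫ ω, inner ℝ u (ε ω) ∂P = 0

/-- One step of the recursion `θ ↦ θ - α (M (θ - θs) - ε)`. -/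
def centeredStep (M : Ω → E →L[ℝ] E) (ε : Ω → E) (θs : E) (α : ℝ) (θ : E) (ω : Ω) : E :=
  θ + (α • ε ω - α • M ω (θ - θs))

variable {P : Measure Ω} [IsProbabilityMeasure P] {M : Ω → E →L[ℝ] E} {ε : Ω → E}
  {Mbar Q : E →L[ℝ] E} {K l u : ℝ} {θs : E} {α : ℝ}

omit [IsProbabilityMeasure P] in
lemma CenteredNoise.measurable_centeredStep (h : CenteredNoise P M ε Mbar K) (θ : E) :
    Measurable (centeredStep M ε θs α θ) := by
  unfold centeredStep
  have h1 := h.measurable_eps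
  have h2 := h.measurable_apply (θ - θs)
  fun_prop

lemma CenteredNoise.integrable_apply (h : CenteredNoise P M ε Mbar K) (x : E) :
    Integrable (fun ω => M ω x) P := by
  refine Integrable.of_bound (h.measurable_apply x).aestronglyMeasurable (K * ‖x‖) ?_
  filter_upwards [h.bound] with ω hω
  exact (M ω).le_of_opNorm_le hω x

lemma CenteredNoise.memLp_two (h : CenteredNoise P M ε Mbar K) : MemLp ε 2 P :=
  h.memLp_eps.mono_exponent (by norm_num)

lemma CenteredNoise.integrable_eps (h : CenteredNoise P M ε Mbar K) : Integrable ε P :=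
  h.memLp_eps.integrable (by norm_num)

lemma CenteredNoise.integrable_sq (h : CenteredNoise P M ε Mbar K) :
    Integrable (fun ω => ‖ε ω‖ ^ 2) P :=
  (memLp_two_iff_integrable_sq_norm h.measurable_eps.aestronglyMeasurable).1 h.memLp_two

omit [IsProbabilityMeasure P] in
lemma CenteredNoise.integrable_cube [IsFiniteMeasure P] (h : CenteredNoise P M ε Mbar K) :
    Integrable (fun ω => ‖ε ω‖ ^ 3) P :=
  h.memLp_eps.integrable_norm_pow'

/-- The cross term averages to −α‖x‖² by the Lyapunov equation, and the quadratic term is bounded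
through |p + q|² ≤ 2p² + 2q². The noise has its own coefficient `β`: β = α describes the chain
around θ*, and β = 0 the difference of two chains driven by the same data, where the noise cancels.
-/
lemma CenteredNoise.form_increment_le (h : CenteredNoise P M ε Mbar K)
    (hQ : IsLyapunov Mbar Q l u) (α β : ℝ) (x : E) :
    Integrable (fun ω => inner ℝ (Q (x + (β • ε ω - α • M ω x))) (x + (β • ε ω - α • M ω x))) P ∧
    ∫ ω, inner ℝ (Q (x + (β • ε ω - α • M ω x))) (x + (β • ε ω - α • M ω x)) ∂P
      ≤ inner ℝ (Q x) x - (α - 2 * α ^ 2 * (u * K ^ 2)) * ‖x‖ ^ 2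
        + 2 * β ^ 2 * u * ∫ ω, ‖ε ω‖ ^ 2 ∂P := by
  simp_rw [hQ.form_add]
  set w : Ω → E := fun ω => β • ε ω - α • M ω x with hw
  have hwm : Measurable w := by
    have h1 := h.measurable_eps
    have h2 := h.measurable_apply x
    fun_prop
  have hwi : Integrable w P := (h.integrable_eps.smul β).sub ((h.integrable_apply x).smul α)
  have hwle : ∀ᵐ ω ∂P, inner ℝ (Q (w ω)) (w ω) ≤
      2 * β ^ 2 * u * ‖ε ω‖ ^ 2 + 2 * α ^ 2 * (u * K ^ 2) * ‖x‖ ^ 2 := by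
    filter_upwards [h.bound] with ω hω
    have h1 : ‖M ω x‖ ≤ K * ‖x‖ := (M ω).le_of_opNorm_le hω x
    have h2 : ‖w ω‖ ≤ |β| * ‖ε ω‖ + |α| * (K * ‖x‖) := by
      refine (norm_sub_le _ _).trans ?_
      rw [norm_smul, norm_smul, Real.norm_eq_abs, Real.norm_eq_abs]
      gcongr
    have h3 : ‖w ω‖ ^ 2 ≤ 2 * (β ^ 2 * ‖ε ω‖ ^ 2) + 2 * (α ^ 2 * (K ^ 2 * ‖x‖ ^ 2)) := by
      calc ‖w ω‖ ^ 2 ≤ (|β| * ‖ε ω‖ + |α| * (K * ‖x‖)) ^ 2 := by gcongr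
        _ ≤ 2 * (|β| * ‖ε ω‖) ^ 2 + 2 * (|α| * (K * ‖x‖)) ^ 2 := by
          nlinarith [sq_nonneg (|β| * ‖ε ω‖ - |α| * (K * ‖x‖))]
        _ = _ := by simp only [mul_pow, sq_abs]
    have h4 := mul_le_mul_of_nonneg_left h3 hQ.pos_u.le
    linarith [hQ.upper (w ω)]
  have hdom : Integrable (fun ω => 2 * β ^ 2 * u * ‖ε ω‖ ^ 2
      + 2 * α ^ 2 * (u * K ^ 2) * ‖x‖ ^ 2) P :=
    (h.integrable_sq.const_mul _).add (integrable_const _)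
  have hqi : Integrable (fun ω => inner ℝ (Q (w ω)) (w ω)) P := by
    refine hdom.mono' ?_ ?_
    · have : Measurable fun ω => inner ℝ (Q (w ω)) (w ω) := by fun_prop
      exact this.aestronglyMeasurable
    · filter_upwards [hwle] with ω hω
      rwa [Real.norm_of_nonneg (hQ.form_nonneg _)]
  have hli : Integrable (fun ω => inner ℝ (Q x) (w ω)) P := hwi.const_inner _
  have hlin : ∫ ω, inner ℝ (Q x) (w ω) ∂P = -(α * inner ℝ (Q x) (Mbar x)) := by
    simp only [hw, inner_sub_right, inner_smul_right]
    rw [integral_sub ((h.integrable_eps.const_inner _).const_mul β)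
      (((h.integrable_apply x).const_inner _).const_mul α), integral_const_mul,
      integral_const_mul, h.mean, h.mean_eps]
    ring
  have hi2 : Integrable (fun ω => inner ℝ (Q x) x + 2 * inner ℝ (Q x) (w ω)) P :=
    (integrable_const _).add (hli.const_mul 2)
  refine ⟨hi2.add hqi, ?_⟩
  rw [integral_add hi2 hqi, integral_add (integrable_const _) (hli.const_mul 2),
    integral_const_mul, hlin]
  have h5 := integral_mono_ae hqi hdom hwle
  rw [integral_add (h.integrable_sq.const_mul _) (integrable_const _), integral_const_mul] at h5
  have h6 := hQ.lyapunov x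
  simp only [integral_const, probReal_univ, one_smul] at h5 ⊢
  have h7 : 2 * (α * inner ℝ (Q x) (Mbar x)) = α * ‖x‖ ^ 2 := by rw [← h6]; ring
  linarith

/-- The step size condition lets the second-order term consume at most half of the gain α‖x‖². -/
lemma CenteredNoise.form_increment_le_of_small (h : CenteredNoise P M ε Mbar K)
    (hQ : IsLyapunov Mbar Q l u) (hα0 : 0 ≤ α) (hα : α * (u * K ^ 2) ≤ 1 / 4) (β : ℝ) (x : E) :
    ∫ ω, inner ℝ (Q (x + (β • ε ω - α • M ω x))) (x + (β • ε ω - α • M ω x)) ∂P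
      ≤ inner ℝ (Q x) x - α / 2 * ‖x‖ ^ 2 + 2 * β ^ 2 * u * ∫ ω, ‖ε ω‖ ^ 2 ∂P := by
  refine (h.form_increment_le hQ α β x).2.trans ?_
  have : α / 2 ≤ α - 2 * α ^ 2 * (u * K ^ 2) := by nlinarith
  have := mul_le_mul_of_nonneg_right this (sq_nonneg ‖x‖)
  linarith

/-- The factor by which `⟨Q x, x⟩` contracts in one step of size `α`. -/
def contractionFactor (u α : ℝ) : ℝ := max 0 (1 - α / (2 * u))

lemma contractionFactor_nonneg (u α : ℝ) : 0 ≤ contractionFactor u α := le_max_left _ _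

lemma contractionFactor_lt_one {u α : ℝ} (hu : 0 < u) (hα : 0 < α) :
    contractionFactor u α < 1 := by
  have : 0 < α / (2 * u) := by positivity
  exact max_lt one_pos (by linarith)

omit [FiniteDimensional ℝ E] [MeasurableSpace E] [BorelSpace E] in
lemma IsLyapunov.sub_le_contractionFactor_mul (hQ : IsLyapunov Mbar Q l u) (hα0 : 0 ≤ α) (x : E) :
    inner ℝ (Q x) x - α / 2 * ‖x‖ ^ 2 ≤ contractionFactor u α * inner ℝ (Q x) x := by
  have h1 : (1 - α / (2 * u)) * inner ℝ (Q x) x ≤ contractionFactor u α * inner ℝ (Q x) x :=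
    mul_le_mul_of_nonneg_right (le_max_right _ _) (hQ.form_nonneg x)
  have h2 : α / (2 * u) * inner ℝ (Q x) x ≤ α / (2 * u) * (u * ‖x‖ ^ 2) :=
    mul_le_mul_of_nonneg_left (hQ.upper x) (by have := hQ.pos_u; positivity)
  have h3 : α / (2 * u) * (u * ‖x‖ ^ 2) = α / 2 * ‖x‖ ^ 2 := by
    have := hQ.pos_u
    field_simp
  linarith

/-- Synchronous coupling: with the same `M` and `ε` at both points, the difference follows the
noiseless recursion. Its mean gauge is at most the root of the mean form, whence the square root in
the factor. -/
lemma CenteredNoise.isGaugeContraction (h : CenteredNoise P M ε Mbar K)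
    (hQ : IsLyapunov Mbar Q l u) (hα0 : 0 < α) (hα : α * (u * K ^ 2) ≤ 1 / 4)
    {κ : Kernel E E} (hκ : ∀ θ, κ θ = P.map (centeredStep M ε θs α θ)) :
    IsGaugeContraction κ (gauge Q) √(contractionFactor u α) := by
  intro L f hL hf
  have hfm : Measurable f := (hf.continuous (continuous_gauge Q) (gauge_zero Q)).measurable
  have hop : ∀ θ, markovOp κ f θ = ∫ ω, f (centeredStep M ε θs α θ ω) ∂P := fun θ => by
    rw [markovOp, hκ, integral_map (h.measurable_centeredStep θ).aemeasurable
      hfm.aestronglyMeasurable]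
  have hint : ∀ θ, Integrable (fun ω => f (centeredStep M ε θs α θ ω)) P := fun θ =>
    Integrable.of_bound (hfm.comp (h.measurable_centeredStep θ)).aestronglyMeasurable 1
      (.of_forall fun _ => hf.norm_le_one _)
  constructor
  · intro x
    rw [hop]
    refine (norm_integral_le_of_norm_le_const (C := 1) (.of_forall fun _ => hf.norm_le_one _)).trans
      ?_
    simp
  · intro x y
    rw [hop, hop, ← integral_sub (hint x) (hint y)]
    set z := x - y with hz
    set g : Ω → ℝ := fun ω => gauge Q (z + ((0 : ℝ) • ε ω - α • M ω z)) with hg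
    have hfin := h.form_increment_le hQ α 0 z
    have hgm : Measurable g := by
      have h1 := h.measurable_eps
      have h2 := h.measurable_apply z
      have h3 := (continuous_gauge Q).measurable
      fun_prop
    have hgsq : ∀ ω, g ω ^ 2 = inner ℝ (Q (z + ((0 : ℝ) • ε ω - α • M ω z)))
        (z + ((0 : ℝ) • ε ω - α • M ω z)) := fun ω => Real.sq_sqrt (hQ.form_nonneg _)
    have hg2 : MemLp g 2 P := by
      rw [memLp_two_iff_integrable_sq hgm.aestronglyMeasurable]
      simp_rw [hgsq]
      exact hfin.1
    have hgi : Integrable g P := hg2.integrable (by norm_num)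
    have hle : ∫ ω, g ω ∂P ≤ √(contractionFactor u α) * gauge Q z := by
      have hvar : (∫ ω, g ω ∂P) ^ 2 ≤ ∫ ω, g ω ^ 2 ∂P := by
        have h1 := variance_nonneg g P
        rw [variance_eq_sub hg2] at h1
        simpa using h1
      rw [gauge, ← Real.sqrt_mul (contractionFactor_nonneg u α)]
      refine Real.le_sqrt_of_sq_le (hvar.trans ?_)
      simp_rw [hgsq]
      refine (h.form_increment_le_of_small hQ hα0.le hα 0 z).trans ?_
      have := hQ.sub_le_contractionFactor_mul hα0.le z
      simpa using this
    calc ‖∫ ω, (f (centeredStep M ε θs α x ω) - f (centeredStep M ε θs α y ω)) ∂P‖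
        ≤ ∫ ω, L * g ω ∂P := by
          refine norm_integral_le_of_norm_le (hgi.const_mul L) (.of_forall fun ω => ?_)
          refine (hf.norm_sub_le _ _).trans_eq ?_
          simp only [hg, hz, centeredStep]
          congr 2
          simp only [map_sub, smul_sub]
          module
      _ ≤ L * (√(contractionFactor u α) * gauge Q z) := by
          rw [integral_const_mul]
          gcongr
      _ = _ := by ring

omit [IsProbabilityMeasure P] in
lemma centeredStep_sub (θ : E) (ω : Ω) :
    centeredStep M ε θs α θ ω - θs = (θ - θs) + (α • ε ω - α • M ω (θ - θs)) := by
  rw [centeredStep]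
  abel

lemma CenteredNoise.lintegral_form_le (h : CenteredNoise P M ε Mbar K)
    (hQ : IsLyapunov Mbar Q l u) (hα0 : 0 < α) (hα : α * (u * K ^ 2) ≤ 1 / 4)
    {κ : Kernel E E} (hκ : ∀ θ, κ θ = P.map (centeredStep M ε θs α θ)) (θ : E) :
    ∫⁻ y, ENNReal.ofReal (inner ℝ (Q (y - θs)) (y - θs)) ∂(κ θ) ≤
      ENNReal.ofReal (contractionFactor u α * inner ℝ (Q (θ - θs)) (θ - θs)
        + 2 * α ^ 2 * u * ∫ ω, ‖ε ω‖ ^ 2 ∂P) := by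
  rw [hκ, lintegral_map (by fun_prop) (h.measurable_centeredStep θ)]
  simp_rw [centeredStep_sub]
  rw [← ofReal_integral_eq_lintegral_ofReal (h.form_increment_le hQ α α _).1
    (.of_forall fun ω => hQ.form_nonneg _)]
  refine ENNReal.ofReal_le_ofReal ((h.form_increment_le_of_small hQ hα0.le hα α _).trans ?_)
  gcongr
  exact hQ.sub_le_contractionFactor_mul hα0.le _

lemma CenteredNoise.exists_invariant (h : CenteredNoise P M ε Mbar K)
    (hQ : IsLyapunov Mbar Q l u) (hα0 : 0 < α) (hα : α * (u * K ^ 2) ≤ 1 / 4)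
    {κ : Kernel E E} [IsMarkovKernel κ] (hκ : ∀ θ, κ θ = P.map (centeredStep M ε θs α θ)) :
    ∃ π : Measure E, IsProbabilityMeasure π ∧ κ.Invariant π ∧ MemLp id 2 π := by
  have hu := hQ.pos_u
  have hl := hQ.pos_l
  obtain ⟨π, hπ, hinv, hmom⟩ := (h.isGaugeContraction hQ hα0 hα hκ).exists_invariant
    (Real.sqrt_nonneg _)
    (by
      rw [Real.sqrt_lt' one_pos, one_pow]
      exact contractionFactor_lt_one hu hα0)
    (continuous_gauge Q) (gauge_zero Q) (by positivity) hQ.norm_le_gauge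
    (V := fun θ => inner ℝ (Q (θ - θs)) (θ - θs)) (by fun_prop) (θs := θs) hl
    (fun x => hQ.lower _) (by simp) (contractionFactor_nonneg u α)
    (contractionFactor_lt_one hu hα0)
    (D := 2 * α ^ 2 * u * ∫ ω, ‖ε ω‖ ^ 2 ∂P)
    (by have : 0 ≤ ∫ ω, ‖ε ω‖ ^ 2 ∂P := integral_nonneg fun _ => by positivity
        positivity)
    (fun θ => h.lintegral_form_le hQ hα0 hα hκ θ)
  refine ⟨π, hπ, hinv, ?_⟩
  have hint : Integrable (fun θ => inner ℝ (Q (θ - θs)) (θ - θs)) π := by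
    refine ⟨by fun_prop, ?_⟩
    rw [hasFiniteIntegral_iff_ofReal (.of_forall fun x => hQ.form_nonneg _)]
    exact hmom
  have h2 : MemLp (fun θ => θ - θs) 2 π := by
    rw [memLp_two_iff_integrable_sq_norm (by fun_prop)]
    refine (hint.const_mul l⁻¹).mono' (by fun_prop) (.of_forall fun x => ?_)
    rw [Real.norm_of_nonneg (by positivity), inv_mul_eq_div, le_div_iff₀ hl, mul_comm]
    exact hQ.lower _
  have := h2.add (memLp_const θs)
  refine this.congr_norm (by fun_prop) (.of_forall fun x => ?_)
  simp

lemma CenteredNoise.invariant_unique (h : CenteredNoise P M ε Mbar K)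
    (hQ : IsLyapunov Mbar Q l u) (hα0 : 0 < α) (hα : α * (u * K ^ 2) ≤ 1 / 4)
    {κ : Kernel E E} [IsMarkovKernel κ] (hκ : ∀ θ, κ θ = P.map (centeredStep M ε θs α θ))
    {π π' : Measure E} [IsProbabilityMeasure π] [IsProbabilityMeasure π']
    (hπ : κ.Invariant π) (hπ' : κ.Invariant π') : π = π' := by
  have hu := hQ.pos_u
  have hl := hQ.pos_l
  have : CompleteSpace E := FiniteDimensional.complete ℝ E
  exact (h.isGaugeContraction hQ hα0 hα hκ).invariant_unique (Real.sqrt_nonneg _)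
    (by
      rw [Real.sqrt_lt' one_pos, one_pow]
      exact contractionFactor_lt_one hu hα0)
    (continuous_gauge Q) (gauge_zero Q) (by positivity) hQ.norm_le_gauge hπ hπ'

/-- The mean square error under a stationary law is at most of the order of the step size. -/
lemma CenteredNoise.integral_norm_sq_le (h : CenteredNoise P M ε Mbar K)
    (hQ : IsLyapunov Mbar Q l u) (hα0 : 0 < α) (hα : α * (u * K ^ 2) ≤ 1 / 4)
    {κ : Kernel E E} [IsMarkovKernel κ] (hκ : ∀ θ, κ θ = P.map (centeredStep M ε θs α θ))
    {π : Measure E} [IsProbabilityMeasure π] (hπ : κ.Invariant π) (hπ2 : MemLp id 2 π) :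
    ∫ θ, ‖θ - θs‖ ^ 2 ∂π ≤ α * (4 * u * ∫ ω, ‖ε ω‖ ^ 2 ∂P) := by
  set m := ∫ ω, ‖ε ω‖ ^ 2 ∂P with hm
  have hm0 : 0 ≤ m := integral_nonneg fun _ => by positivity
  have hu := hQ.pos_u
  have h2 : MemLp (fun θ => θ - θs) 2 π := hπ2.sub (memLp_const θs)
  have hsq : Integrable (fun θ => ‖θ - θs‖ ^ 2) π :=
    (memLp_two_iff_integrable_sq_norm (by fun_prop)).1 h2
  set V : E → ℝ := fun θ => inner ℝ (Q (θ - θs)) (θ - θs) with hV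
  have hVc : Continuous V := by fun_prop
  have hVi : Integrable V π := by
    refine (hsq.const_mul u).mono' (by fun_prop) (.of_forall fun x => ?_)
    rw [Real.norm_of_nonneg (hQ.form_nonneg _)]
    exact hQ.upper _
  have hVi' : Integrable V (π.bind κ) := by rwa [hπ.def]
  -- By stationarity a step leaves the mean of `V` unchanged, so the mean decrease α‖θ − θ*‖²/2 is
  -- paid for by the noise term 2α²um alone.
  have h1 : ∫ θ, V θ ∂π = ∫ θ, ∫ y, V y ∂(κ θ) ∂π := by
    conv_lhs => rw [← hπ.def]
    rw [Measure.comp_eq_comp_const_apply] at hVi' ⊢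
    rw [Kernel.integral_comp hVi']
    simp
  have hκi : Integrable (fun θ => ∫ y, V y ∂(κ θ)) π := by
    rw [Measure.comp_eq_comp_const_apply] at hVi'
    simpa using hVi'.integral_comp
  have h3 : ∀ θ, ∫ y, V y ∂(κ θ) ≤ V θ - α / 2 * ‖θ - θs‖ ^ 2 + 2 * α ^ 2 * u * m := by
    intro θ
    rw [hκ, integral_map (h.measurable_centeredStep θ).aemeasurable (by fun_prop)]
    simp_rw [hV, centeredStep_sub]
    exact h.form_increment_le_of_small hQ hα0.le hα α _
  have hsub : Integrable (fun θ => V θ - α / 2 * ‖θ - θs‖ ^ 2) π := hVi.sub (hsq.const_mul (α / 2))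
  have h4 := integral_mono hκi (hsub.add (integrable_const (2 * α ^ 2 * u * m))) h3
  simp only [Pi.add_apply] at h4
  rw [← h1, integral_add hsub (integrable_const _), integral_sub hVi (hsq.const_mul _), integral_const_mul] at h4
  simp only [integral_const, probReal_univ, one_smul] at h4
  have h5 : α * ∫ θ, ‖θ - θs‖ ^ 2 ∂π ≤ α * (α * (4 * u * m)) := by nlinarith
  exact le_of_mul_le_mul_left h5 hα0

end LinearChain

/-! ### Taylor bounds for the complex exponential on the imaginary axis. -/

section ExpansionBounds

open Complex in
lemma norm_exp_mul_I_sub_one_sub_le (a : ℝ) :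
    ‖exp (a * I) - 1 - a * I‖ ≤ 3 * a ^ 2 := by
  rcases le_total |a| 1 with ha | ha
  · have h := norm_exp_sub_sum_le_norm_mul_exp (a * I) 2
    simp only [Finset.sum_range_succ, Finset.sum_range_zero, norm_mul, norm_I, norm_real,
      Real.norm_eq_abs, mul_one, sq_abs] at h
    have h1 : Real.exp |a| ≤ 3 :=
      (Real.exp_le_exp.2 ha).trans (by linarith [Real.exp_one_lt_d9])
    calc _ = ‖exp (a * I) - (0 + (a * I) ^ 0 / (Nat.factorial 0 : ℕ)
            + (a * I) ^ 1 / (Nat.factorial 1 : ℕ))‖ := by congr 1; simp; ring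
      _ ≤ _ := h
      _ ≤ a ^ 2 * 3 := by gcongr
      _ = _ := by ring
  · calc ‖exp (a * I) - 1 - a * I‖ ≤ ‖exp (a * I) - 1‖ + ‖a * I‖ := norm_sub_le _ _
      _ ≤ (‖exp (a * I)‖ + ‖(1 : ℂ)‖) + ‖a * I‖ := by gcongr; exact norm_sub_le _ _
      _ = 2 + |a| := by
        rw [norm_exp_ofReal_mul_I, norm_mul, norm_I, norm_real, norm_one, Real.norm_eq_abs]; ring
      _ ≤ 3 * a ^ 2 := by rw [← sq_abs a]; nlinarith

open Complex in
lemma norm_exp_mul_I_sub_taylor_two_le (a : ℝ) :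
    ‖exp (a * I) - (1 + a * I - a ^ 2 / 2)‖ ≤ 4 * |a| ^ 3 := by
  rcases le_total |a| 1 with ha | ha
  · have h := norm_exp_sub_sum_le_norm_mul_exp (a * I) 3
    simp only [Finset.sum_range_succ, Finset.sum_range_zero, norm_mul, norm_I, norm_real,
      Real.norm_eq_abs, mul_one] at h
    have h1 : Real.exp |a| ≤ 4 :=
      (Real.exp_le_exp.2 ha).trans (by linarith [Real.exp_one_lt_d9])
    calc _ = ‖exp (a * I) - (0 + (a * I) ^ 0 / (Nat.factorial 0 : ℕ)
            + (a * I) ^ 1 / (Nat.factorial 1 : ℕ) + (a * I) ^ 2 / (Nat.factorial 2 : ℕ))‖ := by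
          congr 1
          simp [mul_pow]
          ring
      _ ≤ _ := h
      _ ≤ |a| ^ 3 * 4 := by gcongr
      _ = _ := by ring
  · calc ‖exp (a * I) - (1 + a * I - a ^ 2 / 2)‖
        ≤ ‖exp (a * I)‖ + ‖1 + a * I - (a : ℂ) ^ 2 / 2‖ := norm_sub_le _ _
      _ ≤ ‖exp (a * I)‖ + (‖1 + a * I‖ + ‖(a : ℂ) ^ 2 / 2‖) := by gcongr; exact norm_sub_le _ _
      _ ≤ ‖exp (a * I)‖ + (‖(1 : ℂ)‖ + ‖a * I‖ + ‖(a : ℂ) ^ 2 / 2‖) := by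
        gcongr; exact norm_add_le _ _
      _ = 2 + |a| + |a| ^ 2 / 2 := by
        rw [norm_exp_ofReal_mul_I, norm_mul, norm_I, norm_real, norm_one, norm_div, norm_pow,
          norm_real, Real.norm_eq_abs, RCLike.norm_two]; ring
      _ ≤ 4 * |a| ^ 3 := by
        have : |a| ≤ |a| ^ 2 := by nlinarith
        have : |a| ^ 2 ≤ |a| ^ 3 := by nlinarith [sq_nonneg |a|]
        nlinarith

-- In the application a = O(s) and b = O(s²). Hence `a` is expanded to second order and `b` only to
-- first; every term on the right is then O(s³).
open Complex in
lemma norm_exp_add_mul_I_sub_le (a b : ℝ) :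
    ‖exp ((a + b : ℝ) * I) - (1 + (a + b : ℝ) * I - (a ^ 2 / 2 : ℝ))‖
      ≤ 4 * |a| ^ 3 + 3 * b ^ 2 + |a| * |b| := by
  have e : exp ((a + b : ℝ) * I) - (1 + (a + b : ℝ) * I - (a ^ 2 / 2 : ℝ))
      = (exp (a * I) - (1 + a * I - a ^ 2 / 2)) + exp (a * I) * (exp (b * I) - 1 - b * I)
        + b * I * (exp (a * I) - exp ((0 : ℝ) * I)) := by
    rw [show ((a + b : ℝ) : ℂ) * I = a * I + b * I by push_cast; ring, exp_add]
    push_cast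
    rw [zero_mul, exp_zero]
    ring
  rw [e]
  refine (norm_add₃_le).trans ?_
  have h1 := norm_exp_mul_I_sub_taylor_two_le a
  have h2 := norm_exp_mul_I_sub_one_sub_le b
  have h3 := norm_exp_mul_I_sub_le a 0
  rw [norm_mul, norm_exp_ofReal_mul_I, one_mul, norm_mul, norm_mul, norm_I, norm_real,
    Real.norm_eq_abs, mul_one]
  rw [sub_zero] at h3
  have h4 := mul_le_mul_of_nonneg_left h3 (abs_nonneg b)
  linarith

end ExpansionBounds

/-! ### The approximate functional equation of the stationary characteristic function. -/

section OneStep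

variable {E : Type*} [NormedAddCommGroup E] [InnerProductSpace ℝ E] [FiniteDimensional ℝ E]
  [MeasurableSpace E] [BorelSpace E] {Ω : Type*} [MeasurableSpace Ω]
  {P : Measure Ω} [IsProbabilityMeasure P] {M : Ω → E →L[ℝ] E} {ε : Ω → E}
  {Mbar Q : E →L[ℝ] E} {K l u : ℝ} {θs : E}

/-- The quadratic form of the covariance of the noise. -/
def noiseForm (P : Measure Ω) (ε : Ω → E) (t : E) : ℝ := ∫ ω, inner ℝ (ε ω) t ^ 2 ∂P

/-- The constant of the one-step expansion of the characteristic function. -/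
def expansionConst (P : Measure Ω) (ε : Ω → E) (K : ℝ) : ℝ :=
  4 * ∫ ω, ‖ε ω‖ ^ 3 ∂P + 3 * K ^ 2 + K * ∫ ω, ‖ε ω‖ ∂P

omit [FiniteDimensional ℝ E] [BorelSpace E] [IsProbabilityMeasure P] in
lemma noiseForm_nonneg (t : E) : 0 ≤ noiseForm P ε t := integral_nonneg fun _ => sq_nonneg _

lemma CenteredNoise.noiseForm_le (h : CenteredNoise P M ε Mbar K) (t : E) :
    noiseForm P ε t ≤ (∫ ω, ‖ε ω‖ ^ 2 ∂P) * ‖t‖ ^ 2 := by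
  rw [noiseForm, ← integral_mul_const]
  refine integral_mono_of_nonneg (.of_forall fun _ => sq_nonneg _)
    (h.integrable_sq.mul_const _) (.of_forall fun ω => ?_)
  change inner ℝ (ε ω) t ^ 2 ≤ ‖ε ω‖ ^ 2 * ‖t‖ ^ 2
  rw [← mul_pow, ← sq_abs]
  gcongr
  exact abs_real_inner_le_norm _ _

/-- The phase after one step is z + a + b, with z = ⟨y − s²M̄y, t⟩ deterministic, a = s⟨ε,t⟩ and b =
s²⟨(M̄ − M)y, t⟩. Both a and b are centered, so only the mean of a²/2 survives at order s². `M` and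
`ε` may be correlated: their product enters only through |a||b| = O(s³). -/
lemma CenteredNoise.norm_integral_exp_sub_le (h : CenteredNoise P M ε Mbar K) (hK : 0 ≤ K)
    {s : ℝ} (hs0 : 0 ≤ s) (hs1 : s ≤ 1) (y t : E) :
    ‖∫ ω, Complex.exp ((inner ℝ (y + (s • ε ω - s ^ 2 • M ω y)) t : ℝ) * Complex.I) ∂P
      - Complex.exp ((inner ℝ y (t - s ^ 2 • ContinuousLinearMap.adjoint Mbar t) : ℝ) * Complex.I)
        * (1 - s ^ 2 * noiseForm P ε t / 2 : ℝ)‖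
      ≤ s ^ 3 * (expansionConst P ε (‖Mbar‖ + K) * (1 + ‖y‖ ^ 2) * (‖t‖ ^ 2 + ‖t‖ ^ 3)) := by
  set K' := ‖Mbar‖ + K with hK'
  have hK'0 : 0 ≤ K' := by positivity
  set m1 := ∫ ω, ‖ε ω‖ ∂P with hm1
  set m3 := ∫ ω, ‖ε ω‖ ^ 3 ∂P with hm3
  have hm10 : 0 ≤ m1 := integral_nonneg fun _ => by positivity
  have hm30 : 0 ≤ m3 := integral_nonneg fun _ => by positivity
  set a : Ω → ℝ := fun ω => s * inner ℝ (ε ω) t with ha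
  set b : Ω → ℝ := fun ω => s ^ 2 * inner ℝ (Mbar y - M ω y) t with hb
  set z : ℝ := inner ℝ y (t - s ^ 2 • ContinuousLinearMap.adjoint Mbar t) with hz
  have hεm := h.measurable_eps
  have hMm := h.measurable_apply y
  have ham : Measurable a := by fun_prop
  have hbm : Measurable b := by fun_prop
  have hinner : ∀ ω, inner ℝ (y + (s • ε ω - s ^ 2 • M ω y)) t = z + (a ω + b ω) := by
    intro ω
    simp only [hz, ha, hb, inner_add_left, inner_sub_left, inner_sub_right, inner_smul_left,
      inner_smul_right, ContinuousLinearMap.adjoint_inner_right, conj_trivial]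
    ring
  have hle1 : ∀ ω, |a ω| ≤ s * ‖ε ω‖ * ‖t‖ := by
    intro ω
    rw [ha, abs_mul, abs_of_nonneg hs0, mul_assoc]
    gcongr
    exact abs_real_inner_le_norm _ _
  have hle2 : ∀ᵐ ω ∂P, |b ω| ≤ s ^ 2 * (K' * ‖y‖ * ‖t‖) := by
    filter_upwards [h.bound] with ω hω
    rw [hb, abs_mul, abs_of_nonneg (sq_nonneg s)]
    gcongr
    refine (abs_real_inner_le_norm _ _).trans ?_
    gcongr
    refine (norm_sub_le _ _).trans ?_
    rw [hK', add_mul]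
    exact add_le_add (Mbar.le_opNorm y) ((M ω).le_of_opNorm_le hω y)
  have hεi : Integrable (fun ω => inner ℝ (ε ω) t) P := h.integrable_eps.inner_const t
  have hai : Integrable a P := hεi.const_mul s
  have hMi : Integrable (fun ω => inner ℝ (M ω y) t) P := (h.integrable_apply y).inner_const t
  have hbi : Integrable b P := by
    simp only [hb, inner_sub_left]
    exact ((integrable_const _).sub hMi).const_mul _
  have hεsq : Integrable (fun ω => inner ℝ (ε ω) t ^ 2) P := by
    refine (h.integrable_sq.mul_const (‖t‖ ^ 2)).mono' (by fun_prop) (.of_forall fun ω => ?_)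
    rw [Real.norm_of_nonneg (sq_nonneg _), ← mul_pow, ← sq_abs]
    gcongr
    exact abs_real_inner_le_norm _ _
  have ha2i : Integrable (fun ω => a ω ^ 2 / 2) P := by
    simp only [ha, mul_pow]
    exact (hεsq.const_mul _).div_const 2
  have hmean_a : ∫ ω, a ω ∂P = 0 := by
    simp only [ha]
    rw [integral_const_mul]
    simp_rw [real_inner_comm t]
    rw [h.mean_eps, mul_zero]
  have hmean_b : ∫ ω, b ω ∂P = 0 := by
    simp only [hb, inner_sub_left]
    rw [integral_const_mul, integral_sub (integrable_const _) hMi]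
    simp_rw [real_inner_comm t]
    rw [h.mean]
    simp
  have hmean_a2 : ∫ ω, a ω ^ 2 / 2 ∂P = s ^ 2 * noiseForm P ε t / 2 := by
    simp only [ha, mul_pow]
    rw [integral_div, integral_const_mul, noiseForm]
  have habi : Integrable (fun ω => a ω + b ω) P := hai.add hbi
  have habc : Integrable (fun ω => ((a ω + b ω : ℝ) : ℂ)) P := habi.ofReal
  have ha2c : Integrable (fun ω => ((a ω ^ 2 / 2 : ℝ) : ℂ)) P := ha2i.ofReal
  have hpoly_i : Integrable (fun ω => 1 + ((a ω + b ω : ℝ) : ℂ) * Complex.I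
      - ((a ω ^ 2 / 2 : ℝ) : ℂ)) P :=
    ((integrable_const _).add (habc.mul_const _)).sub ha2c
  have hpoly : ∫ ω, (1 + ((a ω + b ω : ℝ) : ℂ) * Complex.I - ((a ω ^ 2 / 2 : ℝ) : ℂ)) ∂P
      = (1 - s ^ 2 * noiseForm P ε t / 2 : ℝ) := by
    have h1 : Integrable (fun ω => (1 : ℂ) + ((a ω + b ω : ℝ) : ℂ) * Complex.I) P :=
      (integrable_const _).add (habc.mul_const _)
    rw [integral_sub h1 ha2c, integral_add (integrable_const _) (habc.mul_const _),
      integral_mul_const, integral_complex_ofReal, integral_complex_ofReal, hmean_a2, integral_add hai hbi,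
      hmean_a, hmean_b]
    simp
  have hexp_i : Integrable (fun ω => Complex.exp ((a ω + b ω : ℝ) * Complex.I)) P := by
    refine Integrable.of_bound (by fun_prop) 1 (.of_forall fun ω => ?_)
    exact (Complex.norm_exp_ofReal_mul_I _).le
  have hfac : ∀ ω, Complex.exp ((inner ℝ (y + (s • ε ω - s ^ 2 • M ω y)) t : ℝ) * Complex.I)
      = Complex.exp (z * Complex.I) * Complex.exp ((a ω + b ω : ℝ) * Complex.I) := by
    intro ω
    rw [hinner, ← Complex.exp_add]
    push_cast
    ring_nf
  simp_rw [hfac]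
  rw [integral_const_mul, ← mul_sub, norm_mul, Complex.norm_exp_ofReal_mul_I, one_mul, ← hpoly,
    ← integral_sub hexp_i hpoly_i]
  have hεi1 : Integrable (fun ω => ‖ε ω‖) P := h.integrable_eps.norm
  have hεi3 := h.integrable_cube
  calc _ ≤ ∫ ω, (4 * (s ^ 3 * ‖t‖ ^ 3) * ‖ε ω‖ ^ 3 + (3 * (s ^ 2 * (K' * ‖y‖ * ‖t‖)) ^ 2
        + s * ‖t‖ * (s ^ 2 * (K' * ‖y‖ * ‖t‖)) * ‖ε ω‖)) ∂P := by
        refine norm_integral_le_of_norm_le ((hεi3.const_mul _).add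
          ((integrable_const _).add (hεi1.const_mul _))) ?_
        filter_upwards [hle2] with ω hω
        refine (norm_exp_add_mul_I_sub_le (a ω) (b ω)).trans ?_
        have h1 := hle1 ω
        have h2 : |a ω| ^ 3 ≤ (s * ‖ε ω‖ * ‖t‖) ^ 3 := by gcongr
        have h3 : b ω ^ 2 ≤ (s ^ 2 * (K' * ‖y‖ * ‖t‖)) ^ 2 := by
          rw [← sq_abs (b ω)]; gcongr
        have h4 : |a ω| * |b ω| ≤ (s * ‖ε ω‖ * ‖t‖) * (s ^ 2 * (K' * ‖y‖ * ‖t‖)) := by gcongr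
        calc _ ≤ 4 * (s * ‖ε ω‖ * ‖t‖) ^ 3 + 3 * (s ^ 2 * (K' * ‖y‖ * ‖t‖)) ^ 2
              + (s * ‖ε ω‖ * ‖t‖) * (s ^ 2 * (K' * ‖y‖ * ‖t‖)) := by gcongr
          _ = _ := by ring
    _ = s ^ 3 * (4 * m3 * ‖t‖ ^ 3 + s * (3 * K' ^ 2 * ‖y‖ ^ 2 * ‖t‖ ^ 2)
          + K' * m1 * ‖y‖ * ‖t‖ ^ 2) := by
        have hi2 : Integrable (fun ω => 3 * (s ^ 2 * (K' * ‖y‖ * ‖t‖)) ^ 2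
            + s * ‖t‖ * (s ^ 2 * (K' * ‖y‖ * ‖t‖)) * ‖ε ω‖) P :=
          (integrable_const _).add (hεi1.const_mul _)
        rw [integral_add (hεi3.const_mul _) hi2, integral_add (integrable_const _)
          (hεi1.const_mul _), integral_const_mul (4 * (s ^ 3 * ‖t‖ ^ 3)),
          integral_const_mul (s * ‖t‖ * (s ^ 2 * (K' * ‖y‖ * ‖t‖))), ← hm1, ← hm3]
        simp only [integral_const, probReal_univ, one_smul]
        ring
    _ ≤ s ^ 3 * (4 * m3 * ((1 + ‖y‖ ^ 2) * (‖t‖ ^ 2 + ‖t‖ ^ 3))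
          + 1 * (3 * K' ^ 2 * ((1 + ‖y‖ ^ 2) * (‖t‖ ^ 2 + ‖t‖ ^ 3)))
          + K' * m1 * ((1 + ‖y‖ ^ 2) * (‖t‖ ^ 2 + ‖t‖ ^ 3))) := by
        have hy := norm_nonneg y
        have ht2 : 0 ≤ ‖t‖ ^ 2 := by positivity
        have ht3 : 0 ≤ ‖t‖ ^ 3 := by positivity
        have hy1 : ‖y‖ ≤ 1 + ‖y‖ ^ 2 := by nlinarith [sq_nonneg (‖y‖ - 1)]
        have e1 : ‖t‖ ^ 3 ≤ (1 + ‖y‖ ^ 2) * (‖t‖ ^ 2 + ‖t‖ ^ 3) := by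
          have : 0 ≤ ‖y‖ ^ 2 * (‖t‖ ^ 2 + ‖t‖ ^ 3) := by positivity
          linarith
        have e2 : ‖y‖ ^ 2 * ‖t‖ ^ 2 ≤ (1 + ‖y‖ ^ 2) * (‖t‖ ^ 2 + ‖t‖ ^ 3) :=
          mul_le_mul (by linarith) (by linarith) ht2 (by positivity)
        have e3 : ‖y‖ * ‖t‖ ^ 2 ≤ (1 + ‖y‖ ^ 2) * (‖t‖ ^ 2 + ‖t‖ ^ 3) :=
          mul_le_mul hy1 (by linarith) ht2 (by positivity)
        have e4 : s * (3 * K' ^ 2 * ‖y‖ ^ 2 * ‖t‖ ^ 2)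
            ≤ 1 * (3 * K' ^ 2 * ((1 + ‖y‖ ^ 2) * (‖t‖ ^ 2 + ‖t‖ ^ 3))) := by
          refine mul_le_mul hs1 ?_ (by positivity) zero_le_one
          rw [mul_assoc (3 * K' ^ 2)]
          gcongr
        have e5 : K' * m1 * ‖y‖ * ‖t‖ ^ 2
            ≤ K' * m1 * ((1 + ‖y‖ ^ 2) * (‖t‖ ^ 2 + ‖t‖ ^ 3)) := by
          rw [mul_assoc (K' * m1)]
          gcongr
        have e6 : 4 * m3 * ‖t‖ ^ 3 ≤ 4 * m3 * ((1 + ‖y‖ ^ 2) * (‖t‖ ^ 2 + ‖t‖ ^ 3)) := by gcongr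
        gcongr ?_ * ?_
        linarith
    _ = _ := by rw [expansionConst]; ring

/-- The characteristic function of the error `s⁻¹ (θ - θs)` under the law `π` of `θ`. -/
def errorCharFun (π : Measure E) (θs : E) (s : ℝ) (t : E) : ℂ :=
  ∫ θ, Complex.exp ((inner ℝ (s⁻¹ • (θ - θs)) t : ℝ) * Complex.I) ∂π

omit [FiniteDimensional ℝ E] [MeasurableSpace E] [BorelSpace E] in
lemma gaugeLipschitz_exp_inner_error {N : E → ℝ} {c : ℝ} (hc : ∀ x, ‖x‖ ≤ c * N x) (t : E)
    (s : ℝ) : GaugeLipschitz N (‖s⁻¹ • t‖ * c)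
      fun θ => Complex.exp ((inner ℝ (s⁻¹ • (θ - θs)) t : ℝ) * Complex.I) where
  norm_le_one x := (Complex.norm_exp_ofReal_mul_I _).le
  norm_sub_le x y := by
    refine (norm_exp_mul_I_sub_le _ _).trans ?_
    rw [← inner_sub_left, ← smul_sub, real_inner_smul_left, ← real_inner_smul_right,
      sub_sub_sub_cancel_right]
    calc |inner ℝ (x - y) (s⁻¹ • t)| ≤ ‖x - y‖ * ‖s⁻¹ • t‖ := abs_real_inner_le_norm _ _
      _ ≤ c * N (x - y) * ‖s⁻¹ • t‖ := by gcongr; exact hc _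
      _ = _ := by ring

/-- The one-step expansion is integrated against `π`, which stationarity permits. The factor 1 +
‖y‖² has a mean bounded uniformly in s, since E‖θ − θ*‖² = O(s²). -/
lemma CenteredNoise.norm_errorCharFun_sub_le (h : CenteredNoise P M ε Mbar K) (hK : 0 ≤ K)
    (hQ : IsLyapunov Mbar Q l u) {s : ℝ} (hs0 : 0 < s) (hs1 : s ≤ 1)
    (hα : s ^ 2 * (u * K ^ 2) ≤ 1 / 4)
    {κ : Kernel E E} [IsMarkovKernel κ] (hκ : ∀ θ, κ θ = P.map (centeredStep M ε θs (s ^ 2) θ))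
    {π : Measure E} [IsProbabilityMeasure π] (hπ : κ.Invariant π) (hπ2 : MemLp id 2 π) (t : E) :
    ‖errorCharFun π θs s t - (1 - s ^ 2 * noiseForm P ε t / 2 : ℝ)
        * errorCharFun π θs s (t - s ^ 2 • ContinuousLinearMap.adjoint Mbar t)‖
      ≤ s ^ 3 * (expansionConst P ε (‖Mbar‖ + K) * (1 + 4 * u * ∫ ω, ‖ε ω‖ ^ 2 ∂P)
        * (‖t‖ ^ 2 + ‖t‖ ^ 3)) := by
  have hu := hQ.pos_u
  have hl := hQ.pos_l
  have hcg := h.isGaugeContraction hQ (by positivity) hα hκ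
  set f : E → ℂ := fun θ => Complex.exp ((inner ℝ (s⁻¹ • (θ - θs)) t : ℝ) * Complex.I) with hf
  have hfl := gaugeLipschitz_exp_inner_error (θs := θs) hQ.norm_le_gauge t s
  have hL : 0 ≤ ‖s⁻¹ • t‖ * (√l)⁻¹ := by positivity
  have hop := (hcg _ _ hL hfl).integrable (continuous_gauge Q) (gauge_zero Q) π
  have h1 : errorCharFun π θs s t = ∫ θ, markovOp κ f θ ∂π := by
    rw [errorCharFun]
    conv_lhs => rw [← hπ.def]
    exact integral_bind_eq_integral_markovOp hfl (continuous_gauge Q) (gauge_zero Q)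
  have hfm : Measurable f := (hfl.continuous (continuous_gauge Q) (gauge_zero Q)).measurable
  have h2 : ∀ θ, markovOp κ f θ = ∫ ω, Complex.exp ((inner ℝ ((s⁻¹ • (θ - θs)) +
      (s • ε ω - s ^ 2 • M ω (s⁻¹ • (θ - θs)))) t : ℝ) * Complex.I) ∂P := by
    intro θ
    rw [markovOp, hκ, integral_map (h.measurable_centeredStep θ).aemeasurable
      hfm.aestronglyMeasurable]
    simp only [hf, centeredStep_sub]
    congr with ω
    congr 4
    have : s⁻¹ * s ^ 2 = s := by field_simp
    have e2 : s⁻¹ • (s ^ 2 • ε ω - s ^ 2 • M ω (θ - θs))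
        = s • ε ω - s ^ 2 • M ω (s⁻¹ • (θ - θs)) := by
      rw [smul_sub, smul_smul, this, map_smul, smul_smul, smul_smul, mul_comm (s ^ 2) s⁻¹, this]
    rw [smul_add, e2]
  have hsq : Integrable (fun θ => ‖θ - θs‖ ^ 2) π :=
    (memLp_two_iff_integrable_sq_norm (by fun_prop)).1 (hπ2.sub (memLp_const θs))
  have hei : Integrable (fun θ => Complex.exp ((inner ℝ (s⁻¹ • (θ - θs))
      (t - s ^ 2 • ContinuousLinearMap.adjoint Mbar t) : ℝ) * Complex.I)) π := by
    refine Integrable.of_bound (by fun_prop) 1 (.of_forall fun ω => ?_)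
    exact (Complex.norm_exp_ofReal_mul_I _).le
  rw [h1, errorCharFun, mul_comm, ← integral_mul_const, ← integral_sub hop (hei.mul_const _)]
  set c := expansionConst P ε (‖Mbar‖ + K) with hc
  have hc0 : 0 ≤ c := by
    have h1 : 0 ≤ ∫ ω, ‖ε ω‖ ^ 3 ∂P := integral_nonneg fun _ => by positivity
    have h2 : 0 ≤ ∫ ω, ‖ε ω‖ ∂P := integral_nonneg fun _ => by positivity
    rw [hc, expansionConst]
    positivity
  calc _ ≤ ∫ θ, s ^ 3 * (c * (1 + (s ^ 2)⁻¹ * ‖θ - θs‖ ^ 2) * (‖t‖ ^ 2 + ‖t‖ ^ 3)) ∂π := by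
        refine norm_integral_le_of_norm_le ?_ (.of_forall fun θ => ?_)
        · exact ((((integrable_const _).add (hsq.const_mul _)).const_mul c).mul_const _).const_mul _
        · rw [h2]
          refine (h.norm_integral_exp_sub_le hK hs0.le hs1 _ t).trans_eq ?_
          rw [norm_smul, norm_inv, Real.norm_of_nonneg hs0.le, mul_pow, inv_pow]
    _ = s ^ 3 * (c * (1 + (s ^ 2)⁻¹ * ∫ θ, ‖θ - θs‖ ^ 2 ∂π) * (‖t‖ ^ 2 + ‖t‖ ^ 3)) := by
        rw [integral_const_mul, integral_mul_const, integral_const_mul,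
          integral_add (integrable_const _) (hsq.const_mul _), integral_const_mul]
        simp
    _ ≤ _ := by
        have : (s ^ 2)⁻¹ * ∫ θ, ‖θ - θs‖ ^ 2 ∂π ≤ 4 * u * ∫ ω, ‖ε ω‖ ^ 2 ∂P := by
          rw [inv_mul_le_iff₀ (by positivity)]
          exact h.integral_norm_sq_le hQ (by positivity) hα hκ hπ hπ2
        gcongr s ^ 3 * (c * (1 + ?_) * _)

/-- This crude linear bound at the origin starts the contracting recursion. -/
lemma CenteredNoise.norm_errorCharFun_sub_one_le (h : CenteredNoise P M ε Mbar K)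
    (hQ : IsLyapunov Mbar Q l u) {s : ℝ} (hs0 : 0 < s)
    (hα : s ^ 2 * (u * K ^ 2) ≤ 1 / 4)
    {κ : Kernel E E} [IsMarkovKernel κ] (hκ : ∀ θ, κ θ = P.map (centeredStep M ε θs (s ^ 2) θ))
    {π : Measure E} [IsProbabilityMeasure π] (hπ : κ.Invariant π) (hπ2 : MemLp id 2 π) (t : E) :
    ‖errorCharFun π θs s t - 1‖ ≤ (1 + 4 * u * ∫ ω, ‖ε ω‖ ^ 2 ∂P) * ‖t‖ := by
  have hsq : Integrable (fun θ => ‖θ - θs‖ ^ 2) π :=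
    (memLp_two_iff_integrable_sq_norm (by fun_prop)).1 (hπ2.sub (memLp_const θs))
  have hei : Integrable (fun θ => Complex.exp ((inner ℝ (s⁻¹ • (θ - θs)) t : ℝ) * Complex.I)) π := by
    refine Integrable.of_bound (by fun_prop) 1 (.of_forall fun ω => ?_)
    exact (Complex.norm_exp_ofReal_mul_I _).le
  have e : errorCharFun π θs s t - 1
      = ∫ θ, (Complex.exp ((inner ℝ (s⁻¹ • (θ - θs)) t : ℝ) * Complex.I) - 1) ∂π := by
    rw [integral_sub hei (integrable_const _), errorCharFun]
    simp
  rw [e]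
  calc _ ≤ ∫ θ, (1 + (s ^ 2)⁻¹ * ‖θ - θs‖ ^ 2) * ‖t‖ ∂π := by
        refine norm_integral_le_of_norm_le (((integrable_const _).add (hsq.const_mul _)).mul_const _)
          (.of_forall fun θ => ?_)
        have h1 := norm_exp_mul_I_sub_le (inner ℝ (s⁻¹ • (θ - θs)) t) 0
        simp only [Complex.ofReal_zero, zero_mul, Complex.exp_zero, sub_zero] at h1
        refine h1.trans ((abs_real_inner_le_norm _ _).trans ?_)
        gcongr
        have e3 : (s ^ 2)⁻¹ * ‖θ - θs‖ ^ 2 = ‖s⁻¹ • (θ - θs)‖ ^ 2 := by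
          rw [norm_smul, norm_inv, Real.norm_of_nonneg hs0.le, mul_pow, inv_pow]
        rw [e3]
        nlinarith [sq_nonneg (‖s⁻¹ • (θ - θs)‖ - 1), norm_nonneg (s⁻¹ • (θ - θs))]
    _ = (1 + (s ^ 2)⁻¹ * ∫ θ, ‖θ - θs‖ ^ 2 ∂π) * ‖t‖ := by
        rw [integral_mul_const, integral_add (integrable_const _) (hsq.const_mul _),
          integral_const_mul]
        simp
    _ ≤ _ := by
        have : (s ^ 2)⁻¹ * ∫ θ, ‖θ - θs‖ ^ 2 ∂π ≤ 4 * u * ∫ ω, ‖ε ω‖ ^ 2 ∂P := by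
          rw [inv_mul_le_iff₀ (by positivity)]
          exact h.integral_norm_sq_le hQ (by positivity) hα hκ hπ hπ2
        gcongr (1 + ?_) * _

end OneStep

/-! ### Comparison with the Gaussian characteristic function. -/

section GaussianApproximation

/-- After k iterations the accumulated errors are part of a geometric series and the remaining term
is at most m rᵏ N(t). The constant `m` therefore disappears in the limit; what matters is that `D`
is bounded by a multiple of `N`. -/
lemma le_of_contracting_recursion {E : Type*} {D N : E → ℝ} {B : E → E} {R r e m : ℝ}
    (hr0 : 0 ≤ r) (hr1 : r < 1) (hN : ∀ t, 0 ≤ N t) (he : 0 ≤ e) (hm : 0 ≤ m)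
    (hB : ∀ t, N (B t) ≤ r * N t) (hD : ∀ t, N t ≤ R → D t ≤ D (B t) + e * N t)
    (h0 : ∀ t, N t ≤ R → D t ≤ m * N t) (t : E) (ht : N t ≤ R) :
    D t ≤ e / (1 - r) * N t := by
  have hr : 0 < 1 - r := by linarith
  have hk : ∀ (k : ℕ) (t : E), N t ≤ R → D t ≤ (m * r ^ k + e / (1 - r)) * N t := by
    intro k
    induction k with
    | zero =>
      intro t ht
      refine (h0 t ht).trans ?_
      have : 0 ≤ e / (1 - r) * N t := mul_nonneg (by positivity) (hN t)
      linarith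
    | succ k ih =>
      intro t ht
      have hBt : N (B t) ≤ N t := (hB t).trans (mul_le_of_le_one_left (hN t) hr1.le)
      have h1 := ih (B t) (hBt.trans ht)
      have h2 : (m * r ^ k + e / (1 - r)) * N (B t) ≤ (m * r ^ k + e / (1 - r)) * (r * N t) :=
        mul_le_mul_of_nonneg_left (hB t) (by positivity)
      calc D t ≤ (m * r ^ k + e / (1 - r)) * (r * N t) + e * N t := by linarith [hD t ht]
        _ = _ := by field_simp; ring
  have hlim : Tendsto (fun k : ℕ => (m * r ^ k + e / (1 - r)) * N t) atTop
      (𝓝 ((m * 0 + e / (1 - r)) * N t)) :=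
    (((tendsto_pow_atTop_nhds_zero_of_lt_one hr0 hr1).const_mul m).add_const _).mul_const _
  have := ge_of_tendsto' hlim fun k => hk k t ht
  simpa using this

/-- With R₀ − R₁ = 2v, exp(−R₀/2) is exp(−R₁/2) exp(−v), and exp(−v) differs from 1 − v = 1 − ασ/2 +
α²ρ/2 by at most v². -/
lemma abs_exp_sub_step_le {α σ ρ R₀ R₁ : ℝ} (hρ : 0 ≤ ρ) (hR₁ : 0 ≤ R₁)
    (hR : R₁ = R₀ - α * σ + α ^ 2 * ρ) (hv : |(α * σ - α ^ 2 * ρ) / 2| ≤ 1) :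
    |Real.exp (-R₀ / 2) - (1 - α * σ / 2) * Real.exp (-R₁ / 2)|
      ≤ ((α * σ - α ^ 2 * ρ) / 2) ^ 2 + α ^ 2 * ρ / 2 := by
  set v := (α * σ - α ^ 2 * ρ) / 2 with hvd
  have e1 : Real.exp (-R₀ / 2) - (1 - α * σ / 2) * Real.exp (-R₁ / 2)
      = Real.exp (-R₁ / 2) * ((Real.exp (-v) - 1 - -v) + α ^ 2 * ρ / 2) := by
    have : -R₀ / 2 = -R₁ / 2 + -v := by rw [hR, hvd]; ring
    rw [this, Real.exp_add, hvd]
    ring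
  have h1 : Real.exp (-R₁ / 2) ≤ 1 := Real.exp_le_one_iff.2 (by linarith)
  have h2 : |Real.exp (-v) - 1 - -v| ≤ v ^ 2 := by
    have := Real.norm_exp_sub_one_sub_id_le (x := -v) (by rwa [norm_neg, Real.norm_eq_abs])
    simpa [Real.norm_eq_abs] using this
  rw [e1, abs_mul, Real.abs_exp]
  calc _ ≤ 1 * (|Real.exp (-v) - 1 - -v| + |α ^ 2 * ρ / 2|) := by
        gcongr
        exact abs_add_le _ _
    _ ≤ v ^ 2 + α ^ 2 * ρ / 2 := by
        rw [one_mul, abs_of_nonneg (a := α ^ 2 * ρ / 2) (by positivity)]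
        gcongr

variable {E : Type*} [NormedAddCommGroup E] [InnerProductSpace ℝ E]

/-- The form loses α‖t‖² at first order and regains at most half of it at second order. Hence it
shrinks by 1 − α/(2u), which is at most (1 − α/(4u))². -/
lemma IsLyapunov.gauge_sub_smul_le {N Q : E →L[ℝ] E} {l u α : ℝ} (hQ : IsLyapunov N Q l u)
    (hα0 : 0 ≤ α) (hα1 : α ≤ 4 * u) (hα2 : α * (u * ‖N‖ ^ 2) ≤ 1 / 2) (t : E) :
    gauge Q (t - α • N t) ≤ (1 - α / (4 * u)) * gauge Q t := by
  have hu := hQ.pos_u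
  have h1 : 0 ≤ 1 - α / (4 * u) := by
    rw [sub_nonneg, div_le_one (by positivity)]
    exact hα1
  refine Real.sqrt_le_iff.2 ⟨mul_nonneg h1 (Real.sqrt_nonneg _), ?_⟩
  rw [mul_pow, gauge, Real.sq_sqrt (hQ.form_nonneg t), sub_eq_add_neg t, hQ.form_add]
  have h2 := hQ.upper (α • N t)
  have h3 : ‖α • N t‖ ^ 2 ≤ α ^ 2 * (‖N‖ ^ 2 * ‖t‖ ^ 2) := by
    rw [norm_smul, Real.norm_of_nonneg hα0, ← mul_pow, ← mul_pow]
    gcongr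
    exact N.le_opNorm t
  have h4 := hQ.lyapunov t
  have h5 : α * (α * (u * ‖N‖ ^ 2)) * ‖t‖ ^ 2 ≤ α * (1 / 2) * ‖t‖ ^ 2 := by gcongr
  have h6 : α / (2 * u) * inner ℝ (Q t) t ≤ α / 2 * ‖t‖ ^ 2 := by
    calc _ ≤ α / (2 * u) * (u * ‖t‖ ^ 2) := by gcongr; exact hQ.upper t
      _ = _ := by field_simp
  have h7 : (1 - α / (4 * u)) ^ 2 = 1 - α / (2 * u) + (α / (4 * u)) ^ 2 := by
    field_simp
    ring
  have h8 : 0 ≤ (α / (4 * u)) ^ 2 * inner ℝ (Q t) t :=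
    mul_nonneg (sq_nonneg _) (hQ.form_nonneg t)
  have h9 := mul_le_mul_of_nonneg_left h3 hu.le
  rw [h7]
  have e1 : inner ℝ (Q (-(α • N t))) (-(α • N t)) = inner ℝ (Q (α • N t)) (α • N t) := by
    rw [map_neg, inner_neg_neg]
  have e2 : inner ℝ (Q t) (-(α • N t)) = -(α * inner ℝ (Q t) (N t)) := by
    rw [inner_neg_right, inner_smul_right]
  rw [e1, e2]
  have h10 : 2 * (α * inner ℝ (Q t) (N t)) = α * ‖t‖ ^ 2 := by rw [← h4]; ring
  linarith

variable [FiniteDimensional ℝ E]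
  [MeasurableSpace E] [BorelSpace E] {Ω : Type*} [MeasurableSpace Ω]
  {P : Measure Ω} [IsProbabilityMeasure P] {M : Ω → E →L[ℝ] E} {ε : Ω → E}
  {Mbar Q Q' S : E →L[ℝ] E} {K l u l' u' : ℝ} {θs : E}

/-- A constant bounding the quadratic forms of the noise and of `Nᵀ S N`. -/
def covConst (P : Measure Ω) (ε : Ω → E) (S N : E →L[ℝ] E) : ℝ :=
  (∫ ω, ‖ε ω‖ ^ 2 ∂P) + ‖S‖ * ‖N‖ ^ 2

omit [FiniteDimensional ℝ E] [MeasurableSpace E] [BorelSpace E] [IsProbabilityMeasure P] in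
lemma covConst_nonneg (P : Measure Ω) (ε : Ω → E) (S N : E →L[ℝ] E) : 0 ≤ covConst P ε S N := by
  have : 0 ≤ ∫ ω, ‖ε ω‖ ^ 2 ∂P := integral_nonneg fun _ => by positivity
  rw [covConst]
  positivity

omit [FiniteDimensional ℝ E] in
lemma inner_apply_apply_le (S N : E →L[ℝ] E) (t : E) :
    inner ℝ (S (N t)) (N t) ≤ ‖S‖ * ‖N‖ ^ 2 * ‖t‖ ^ 2 := by
  calc inner ℝ (S (N t)) (N t) ≤ ‖S (N t)‖ * ‖N t‖ := real_inner_le_norm _ _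
    _ ≤ (‖S‖ * (‖N‖ * ‖t‖)) * (‖N‖ * ‖t‖) := by
      gcongr
      · exact (S.le_opNorm _).trans (by gcongr; exact N.le_opNorm t)
      · exact N.le_opNorm t
    _ = _ := by ring

lemma CenteredNoise.noiseForm_add_le (h : CenteredNoise P M ε Mbar K) (S N : E →L[ℝ] E) (t : E) :
    noiseForm P ε t + inner ℝ (S (N t)) (N t) ≤ covConst P ε S N * ‖t‖ ^ 2 := by
  rw [covConst, add_mul]
  exact add_le_add (h.noiseForm_le t) (inner_apply_apply_le S N t)

/-- By the Lyapunov equation of `S`, the form ⟨St,t⟩ changes along t ↦ t − s²Nt by −s²σ(t) at first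
order, exactly what the factor 1 − s²σ(t)/2 compensates. The error is O(s⁴), stated as O(s³) to
match the chain. -/
lemma CenteredNoise.abs_exp_form_sub_le (h : CenteredNoise P M ε Mbar K) {N : E →L[ℝ] E}
    (hSsymm : ∀ x y, inner ℝ (S x) y = inner ℝ x (S y)) (hSnn : ∀ t, 0 ≤ inner ℝ (S t) t)
    (hS : ∀ t, 2 * inner ℝ (S t) (N t) = noiseForm P ε t) {s T : ℝ} (hs0 : 0 < s) (hs1 : s ≤ 1)
    (hT : s ^ 2 * (covConst P ε S N * T ^ 2) ≤ 1) {t : E} (ht : ‖t‖ ≤ T) :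
    |Real.exp (-inner ℝ (S t) t / 2) - (1 - s ^ 2 * noiseForm P ε t / 2) *
        Real.exp (-inner ℝ (S (t - s ^ 2 • N t)) (t - s ^ 2 • N t) / 2)|
      ≤ s ^ 3 * ((covConst P ε S N ^ 2 * T ^ 3 + covConst P ε S N * T) * ‖t‖) := by
  have hc0 := covConst_nonneg P ε S N
  have hσρ := h.noiseForm_add_le S N t
  set c := covConst P ε S N with hc
  have htn := norm_nonneg t
  have hT0 : 0 ≤ T := htn.trans ht
  have hσ0 := noiseForm_nonneg (P := P) (ε := ε) t
  have hρ0 := hSnn (N t)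
  have hSadd : inner ℝ (S (t - s ^ 2 • N t)) (t - s ^ 2 • N t)
      = inner ℝ (S t) t - s ^ 2 * noiseForm P ε t + (s ^ 2) ^ 2 * inner ℝ (S (N t)) (N t) := by
    have : inner ℝ (S (N t)) t = inner ℝ (S t) (N t) := by rw [hSsymm, real_inner_comm]
    rw [← hS]
    simp only [map_sub, map_smul, inner_sub_left, inner_sub_right, inner_smul_left,
      inner_smul_right, conj_trivial, this]
    ring
  set σ := noiseForm P ε t
  set ρ := inner ℝ (S (N t)) (N t)
  have hs4 : (s ^ 2) ^ 2 ≤ s ^ 2 :=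
    pow_le_of_le_one (sq_nonneg s) (pow_le_one₀ hs0.le hs1) two_ne_zero
  have p3 : 0 ≤ (s ^ 2) ^ 2 * ρ := by positivity
  have hvabs : |(s ^ 2 * σ - (s ^ 2) ^ 2 * ρ) / 2| ≤ s ^ 2 * (c * ‖t‖ ^ 2) := by
    have h1 : (s ^ 2) ^ 2 * ρ ≤ s ^ 2 * ρ := by gcongr
    have h2 : 0 ≤ s ^ 2 * σ := by positivity
    have h4 : s ^ 2 * (σ + ρ) ≤ s ^ 2 * (c * ‖t‖ ^ 2) := by gcongr
    rw [abs_le]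
    constructor <;> linarith
  have hv1 : s ^ 2 * (c * ‖t‖ ^ 2) ≤ 1 := le_trans (by gcongr) hT
  refine (abs_exp_sub_step_le hρ0 (hSnn (t - s ^ 2 • N t)) hSadd (hvabs.trans hv1)).trans ?_
  have h1 : ((s ^ 2 * σ - (s ^ 2) ^ 2 * ρ) / 2) ^ 2 ≤ (s ^ 2 * (c * ‖t‖ ^ 2)) ^ 2 := by
    rw [← sq_abs]; gcongr
  have h3 : ‖t‖ ^ 2 ≤ T * ‖t‖ := by
    rw [sq]; gcongr
  have h4 : ‖t‖ ^ 4 ≤ T ^ 3 * ‖t‖ := by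
    calc ‖t‖ ^ 4 = ‖t‖ ^ 3 * ‖t‖ := by ring
      _ ≤ T ^ 3 * ‖t‖ := by gcongr
  have h5 : s ^ 4 ≤ s ^ 3 := pow_le_pow_of_le_one hs0.le hs1 (by norm_num)
  have h6 : (s ^ 2) ^ 2 * ρ ≤ (s ^ 2) ^ 2 * (c * ‖t‖ ^ 2) := by gcongr; linarith
  calc _ ≤ (s ^ 2 * (c * ‖t‖ ^ 2)) ^ 2 + (s ^ 2) ^ 2 * (c * ‖t‖ ^ 2) := by linarith
    _ = s ^ 4 * (c ^ 2 * ‖t‖ ^ 4 + c * ‖t‖ ^ 2) := by ring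
    _ ≤ s ^ 3 * (c ^ 2 * (T ^ 3 * ‖t‖) + c * (T * ‖t‖)) := by gcongr
    _ = _ := by ring

/-- The constant of the one-step comparison with the Gaussian law on the ball of radius `T`. -/
def comparisonConst (P : Measure Ω) (ε : Ω → E) (S N : E →L[ℝ] E) (K u T : ℝ) : ℝ :=
  expansionConst P ε (‖N‖ + K) * (1 + 4 * u * ∫ ω, ‖ε ω‖ ^ 2 ∂P) * (T + T ^ 2)
    + (covConst P ε S N ^ 2 * T ^ 3 + covConst P ε S N * T)

lemma expansionConst_nonneg {P : Measure Ω} {ε : Ω → E} (hK : 0 ≤ K) :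
    0 ≤ expansionConst P ε K := by
  have h1 : 0 ≤ ∫ ω, ‖ε ω‖ ^ 3 ∂P := integral_nonneg fun _ => by positivity
  have h2 : 0 ≤ ∫ ω, ‖ε ω‖ ∂P := integral_nonneg fun _ => by positivity
  rw [expansionConst]
  positivity

lemma comparisonConst_nonneg {P : Measure Ω} {ε : Ω → E} (S N : E →L[ℝ] E) (hK : 0 ≤ K)
    (hu : 0 ≤ u) {T : ℝ} (hT : 0 ≤ T) : 0 ≤ comparisonConst P ε S N K u T := by
  have h1 : 0 ≤ ∫ ω, ‖ε ω‖ ^ 2 ∂P := integral_nonneg fun _ => by positivity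
  have h2 := expansionConst_nonneg (P := P) (ε := ε) (K := ‖N‖ + K) (by positivity)
  have h3 := covConst_nonneg P ε S N
  rw [comparisonConst]
  positivity

/-- The two recursions are subtracted; the common factor 1 − s²σ/2 has modulus at most one. The
error is kept proportional to ‖t‖ so that it decays along the iteration. -/
lemma CenteredNoise.norm_errorCharFun_sub_exp_le (h : CenteredNoise P M ε Mbar K)
    (hK : 0 ≤ K) (hQ : IsLyapunov Mbar Q l u) {N : E →L[ℝ] E}
    (hN : N = ContinuousLinearMap.adjoint Mbar)
    (hSsymm : ∀ x y, inner ℝ (S x) y = inner ℝ x (S y)) (hSnn : ∀ t, 0 ≤ inner ℝ (S t) t)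
    (hS : ∀ t, 2 * inner ℝ (S t) (N t) = noiseForm P ε t) {s T : ℝ} (hs0 : 0 < s) (hs1 : s ≤ 1)
    (hα : s ^ 2 * (u * K ^ 2) ≤ 1 / 4) (hT : s ^ 2 * (covConst P ε S N * T ^ 2) ≤ 1)
    {κ : Kernel E E} [IsMarkovKernel κ] (hκ : ∀ θ, κ θ = P.map (centeredStep M ε θs (s ^ 2) θ))
    {π : Measure E} [IsProbabilityMeasure π] (hπ : κ.Invariant π) (hπ2 : MemLp id 2 π)
    {t : E} (ht : ‖t‖ ≤ T) :
    ‖errorCharFun π θs s t - Real.exp (-inner ℝ (S t) t / 2)‖ ≤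
      ‖errorCharFun π θs s (t - s ^ 2 • N t)
        - Real.exp (-inner ℝ (S (t - s ^ 2 • N t)) (t - s ^ 2 • N t) / 2)‖
      + s ^ 3 * comparisonConst P ε S N K u T * ‖t‖ := by
  have hG := h.abs_exp_form_sub_le hSsymm hSnn hS hs0 hs1 hT ht
  have hF := h.norm_errorCharFun_sub_le hK hQ hs0 hs1 hα hκ hπ hπ2 t
  have hNn : ‖N‖ = ‖Mbar‖ := by rw [hN, LinearIsometryEquiv.norm_map]
  rw [← hN, ← hNn] at hF
  have hc0 := covConst_nonneg P ε S N
  have hσρ := h.noiseForm_add_le S N t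
  have htn := norm_nonneg t
  have hT0 : 0 ≤ T := htn.trans ht
  have hu := hQ.pos_u
  have hσ0 := noiseForm_nonneg (P := P) (ε := ε) t
  have hρ0 := hSnn (N t)
  have hC₁0 : 0 ≤ expansionConst P ε (‖N‖ + K) * (1 + 4 * u * ∫ ω, ‖ε ω‖ ^ 2 ∂P) := by
    have h1 : 0 ≤ ∫ ω, ‖ε ω‖ ^ 2 ∂P := integral_nonneg fun _ => by positivity
    have h2 := expansionConst_nonneg (P := P) (ε := ε) (K := ‖N‖ + K) (by positivity)
    positivity
  rw [comparisonConst]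
  set σ := noiseForm P ε t
  set c := covConst P ε S N
  set C₁ := expansionConst P ε (‖N‖ + K) * (1 + 4 * u * ∫ ω, ‖ε ω‖ ^ 2 ∂P)
  set t' := t - s ^ 2 • N t
  have hF' : s ^ 3 * (C₁ * (‖t‖ ^ 2 + ‖t‖ ^ 3)) ≤ s ^ 3 * (C₁ * ((T + T ^ 2) * ‖t‖)) := by
    have h3 : ‖t‖ ^ 2 + ‖t‖ ^ 3 ≤ (T + T ^ 2) * ‖t‖ := by
      calc ‖t‖ ^ 2 + ‖t‖ ^ 3 = (‖t‖ + ‖t‖ ^ 2) * ‖t‖ := by ring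
        _ ≤ _ := by gcongr
    gcongr
  have hfac : |1 - s ^ 2 * σ / 2| ≤ 1 := by
    have h1 : 0 ≤ s ^ 2 * σ := by positivity
    have h2 : s ^ 2 * σ ≤ s ^ 2 * (c * T ^ 2) := by
      gcongr
      calc σ ≤ c * ‖t‖ ^ 2 := by linarith
        _ ≤ _ := by gcongr
    rw [abs_le]
    constructor <;> linarith
  have hdec : errorCharFun π θs s t - Real.exp (-inner ℝ (S t) t / 2)
      = (errorCharFun π θs s t - (1 - s ^ 2 * σ / 2 : ℝ) * errorCharFun π θs s t')
        + (1 - s ^ 2 * σ / 2 : ℝ) * (errorCharFun π θs s t' - Real.exp (-inner ℝ (S t') t' / 2))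
        - ((Real.exp (-inner ℝ (S t) t / 2) - (1 - s ^ 2 * σ / 2) *
          Real.exp (-inner ℝ (S t') t' / 2) : ℝ) : ℂ) := by
    push_cast
    ring
  calc _ ≤ s ^ 3 * (C₁ * ((T + T ^ 2) * ‖t‖))
        + 1 * ‖errorCharFun π θs s t' - Real.exp (-inner ℝ (S t') t' / 2)‖
        + s ^ 3 * ((c ^ 2 * T ^ 3 + c * T) * ‖t‖) := by
        rw [hdec]
        refine (norm_sub_le _ _).trans (add_le_add ((norm_add_le _ _).trans
          (add_le_add (hF.trans hF') ?_)) ?_)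
        · rw [norm_mul, Complex.norm_real, Real.norm_eq_abs]
          gcongr
        · rw [Complex.norm_real, Real.norm_eq_abs]
          exact hG
    _ = _ := by ring

/-- The characteristic function of the rescaled stationary error is within `O(√α)` of that of the
centered Gaussian law whose covariance operator solves the Lyapunov equation of the noise. -/
theorem CenteredNoise.exists_norm_errorCharFun_sub_exp_le (h : CenteredNoise P M ε Mbar K)
    (hK : 0 ≤ K) (hQ : IsLyapunov Mbar Q l u)
    (hQ' : IsLyapunov (ContinuousLinearMap.adjoint Mbar) Q' l' u')
    (hSsymm : ∀ x y, inner ℝ (S x) y = inner ℝ x (S y)) (hSnn : ∀ t, 0 ≤ inner ℝ (S t) t)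
    (hS : ∀ t, 2 * inner ℝ (S t) (ContinuousLinearMap.adjoint Mbar t) = noiseForm P ε t) (t₀ : E) :
    ∃ C s₀ : ℝ, 0 < s₀ ∧ ∀ s : ℝ, 0 < s → s ≤ s₀ → ∀ (κ : Kernel E E) [IsMarkovKernel κ],
      (∀ θ, κ θ = P.map (centeredStep M ε θs (s ^ 2) θ)) → ∀ (π : Measure E)
      [IsProbabilityMeasure π], κ.Invariant π → MemLp id 2 π →
      ‖errorCharFun π θs s t₀ - Real.exp (-inner ℝ (S t₀) t₀ / 2)‖ ≤ C * s := by
  set N := ContinuousLinearMap.adjoint Mbar with hN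
  have hu := hQ.pos_u
  have hl' := hQ'.pos_l
  have hu' := hQ'.pos_u
  set m2 := ∫ ω, ‖ε ω‖ ^ 2 ∂P with hm2
  have hm20 : 0 ≤ m2 := integral_nonneg fun _ => by positivity
  set c' := (√l')⁻¹ with hc'
  have hc'0 : 0 ≤ c' := by positivity
  -- The gauge ball through `t₀` is stable under t ↦ t − s²Nt and lies in the Euclidean ball of
  -- radius `T`, on which the one-step constants are uniform. The gauge is that of `Q'` because
  -- frequencies move by the adjoint of `Mbar`.
  set R := gauge Q' t₀ with hR
  have hR0 : 0 ≤ R := Real.sqrt_nonneg _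
  set T := c' * R with hT
  have hT0 : 0 ≤ T := by positivity
  set c := covConst P ε S N with hc
  have hc0 : 0 ≤ c := covConst_nonneg P ε S N
  set C := comparisonConst P ε S N K u T with hC
  have hC0 : 0 ≤ C := comparisonConst_nonneg S N hK hu.le hT0
  -- The sum of all quantities that s² has to beat: s ≤ 1/b ≤ 1 gives s²b ≤ 1, and each smallness
  -- condition is read off from one summand.
  set b := 4 * (u * K ^ 2) + 2 * (u' * ‖N‖ ^ 2) + c * T ^ 2 + 1 / (4 * u') + 1 with hb
  have hb1 : 1 ≤ b := by
    have : 0 ≤ 4 * (u * K ^ 2) + 2 * (u' * ‖N‖ ^ 2) + c * T ^ 2 + 1 / (4 * u') := by positivity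
    linarith
  refine ⟨4 * u' * (C * c') * R, b⁻¹, by positivity, fun s hs0 hs κ _ hκ π _ hπ hπ2 => ?_⟩
  have hs1 : s ≤ 1 := hs.trans (inv_le_one_of_one_le₀ hb1)
  have hs2 : s ^ 2 * b ≤ 1 := by
    have h1 : s * b ≤ 1 := by rwa [← le_div_iff₀ (by linarith), one_div]
    calc s ^ 2 * b = s * (s * b) := by ring
      _ ≤ 1 * 1 := mul_le_mul hs1 h1 (by positivity) zero_le_one
      _ = 1 := one_mul 1
  have hsplit : s ^ 2 * (4 * (u * K ^ 2)) + s ^ 2 * (2 * (u' * ‖N‖ ^ 2)) + s ^ 2 * (c * T ^ 2)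
      + s ^ 2 * (1 / (4 * u')) + s ^ 2 ≤ 1 := by
    rw [hb] at hs2
    linarith
  have p1 : 0 ≤ s ^ 2 * (4 * (u * K ^ 2)) := by positivity
  have p2 : 0 ≤ s ^ 2 * (2 * (u' * ‖N‖ ^ 2)) := by positivity
  have p3 : 0 ≤ s ^ 2 * (c * T ^ 2) := by positivity
  have p4 : 0 ≤ s ^ 2 * (1 / (4 * u')) := by positivity
  have p5 : 0 ≤ s ^ 2 := by positivity
  have hα1 : s ^ 2 * (u * K ^ 2) ≤ 1 / 4 := by linarith
  have hα2 : s ^ 2 * (u' * ‖N‖ ^ 2) ≤ 1 / 2 := by linarith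
  have hα3 : s ^ 2 * (c * T ^ 2) ≤ 1 := by linarith
  have hα4 : s ^ 2 ≤ 4 * u' := by
    have : s ^ 2 * (1 / (4 * u')) ≤ 1 := by linarith
    rwa [mul_one_div, div_le_one (by positivity)] at this
  have hT' : ∀ t, gauge Q' t ≤ R → ‖t‖ ≤ T := fun t ht =>
    (hQ'.norm_le_gauge t).trans (mul_le_mul_of_nonneg_left ht hc'0)
  set D : E → ℝ := fun t => ‖errorCharFun π θs s t - Real.exp (-inner ℝ (S t) t / 2)‖ with hD
  have hstep : ∀ t, gauge Q' t ≤ R →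
      D t ≤ D (t - s ^ 2 • N t) + s ^ 3 * (C * c') * gauge Q' t := by
    intro t ht
    refine (h.norm_errorCharFun_sub_exp_le hK hQ hN hSsymm hSnn hS hs0 hs1 hα1 hα3 hκ hπ hπ2
      (hT' t ht)).trans ?_
    calc _ ≤ D (t - s ^ 2 • N t) + s ^ 3 * C * (c' * gauge Q' t) := by
          gcongr
          exact hQ'.norm_le_gauge t
      _ = _ := by ring
  have hinit : ∀ t, gauge Q' t ≤ R →
      D t ≤ ((1 + 4 * u * m2 + ‖S‖ * T) * c') * gauge Q' t := by
    intro t ht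
    have htT := hT' t ht
    have h1 := h.norm_errorCharFun_sub_one_le hQ hs0 hα1 hκ hπ hπ2 t
    have h2 : ‖(1 : ℂ) - Real.exp (-inner ℝ (S t) t / 2)‖ ≤ ‖S‖ * T * ‖t‖ := by
      have h3 : Real.exp (-inner ℝ (S t) t / 2) ≤ 1 :=
        Real.exp_le_one_iff.2 (by linarith [hSnn t])
      have h4 := Real.add_one_le_exp (-inner ℝ (S t) t / 2)
      have h5 : inner ℝ (S t) t ≤ ‖S‖ * T * ‖t‖ := by
        calc inner ℝ (S t) t ≤ ‖S t‖ * ‖t‖ := real_inner_le_norm _ _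
          _ ≤ (‖S‖ * ‖t‖) * ‖t‖ := by gcongr; exact S.le_opNorm t
          _ ≤ _ := by gcongr
      have h6 := hSnn t
      rw [← Complex.ofReal_one, ← Complex.ofReal_sub, Complex.norm_real, Real.norm_eq_abs,
        abs_of_nonneg (by linarith)]
      linarith
    calc D t ≤ (1 + 4 * u * m2) * ‖t‖ + ‖S‖ * T * ‖t‖ := by
          simp only [hD]
          refine (norm_sub_le_norm_sub_add_norm_sub _ 1 _).trans (add_le_add h1 h2)
      _ = (1 + 4 * u * m2 + ‖S‖ * T) * ‖t‖ := by ring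
      _ ≤ (1 + 4 * u * m2 + ‖S‖ * T) * (c' * gauge Q' t) := by
          gcongr
          exact hQ'.norm_le_gauge t
      _ = _ := by ring
  have hx : 0 < s ^ 2 / (4 * u') := by positivity
  have hx1 : s ^ 2 / (4 * u') ≤ 1 := by
    rw [div_le_one (by positivity)]
    exact hα4
  -- The error per step is of order s³ and 1 − r = s²/(4u'), so their ratio is of order s.
  have hfin := le_of_contracting_recursion (D := D) (N := gauge Q') (B := fun t => t - s ^ 2 • N t)
    (R := R) (r := 1 - s ^ 2 / (4 * u')) (by linarith) (by linarith) (fun t => Real.sqrt_nonneg _)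
    (by positivity) (by positivity) (hQ'.gauge_sub_smul_le p5 hα4 hα2) hstep hinit t₀ le_rfl
  refine hfin.trans_eq ?_
  rw [← hR, sub_sub_cancel]
  field_simp

end GaussianApproximation

/-! ### Matrices as operators, and the step size threshold. -/

section MatrixFacts

variable {d : ℕ}

/-- The operator on `ℝ^d` given by a matrix. -/
abbrev opOf (A : Mat d) : Vec d →L[ℝ] Vec d := Matrix.toEuclideanCLM (𝕜 := ℝ) A

lemma act_eq_opOf (A : Mat d) (x : Vec d) : act A x = opOf A x := rfl

lemma inner_opOf (A : Mat d) (x y : Vec d) :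
    inner ℝ x (opOf A y) = x.ofLp ⬝ᵥ (A *ᵥ y.ofLp) := Matrix.inner_toEuclideanCLM A x y

lemma adjoint_opOf (A : Mat d) : ContinuousLinearMap.adjoint (opOf A) = opOf Aᵀ := by
  rw [← ContinuousLinearMap.star_eq_adjoint, opOf, opOf, ← map_star, Matrix.star_eq_conjTranspose,
    Matrix.conjTranspose_eq_transpose_of_trivial]

lemma inner_opOf_left (A : Mat d) (x y : Vec d) :
    inner ℝ (opOf A x) y = inner ℝ x (opOf Aᵀ y) := by
  rw [← adjoint_opOf, ContinuousLinearMap.adjoint_inner_right]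

lemma inner_opOf_symm {Q : Mat d} (hQ : Qᵀ = Q) (x y : Vec d) :
    inner ℝ (opOf Q x) y = inner ℝ x (opOf Q y) := by rw [inner_opOf_left, hQ]

lemma two_mul_inner_opOf {B X N : Mat d} (hX : Xᵀ = X) (h : Bᵀ * X + X * B = N) (x : Vec d) :
    2 * inner ℝ (opOf X x) (opOf B x) = inner ℝ x (opOf N x) := by
  have h1 : inner ℝ (opOf X x) (opOf B x) = inner ℝ x (opOf (X * B) x) := by
    rw [inner_opOf_symm hX, opOf, opOf, opOf, map_mul]; rfl
  have h2 : inner ℝ (opOf X x) (opOf B x) = inner ℝ x (opOf (Bᵀ * X) x) := by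
    rw [real_inner_comm, inner_opOf_left, opOf, opOf, opOf, map_mul]; rfl
  have h3 : opOf N x = opOf (Bᵀ * X) x + opOf (X * B) x := by
    rw [← h, opOf, map_add]; rfl
  rw [h3, inner_add_right, ← h1, ← h2]
  ring

lemma posDef_transpose_eq {Q : Mat d} (hQ : Q.PosDef) : Qᵀ = Q := by
  have := hQ.isHermitian
  rwa [Matrix.IsHermitian, Matrix.conjTranspose_eq_transpose_of_trivial] at this

lemma posDef_inner_opOf_pos {Q : Mat d} (hQ : Q.PosDef) {x : Vec d} (hx : x ≠ 0) :
    0 < inner ℝ (opOf Q x) x := by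
  rw [inner_opOf_symm (posDef_transpose_eq hQ), inner_opOf]
  have := hQ.dotProduct_mulVec_pos (x := x.ofLp) (fun h => hx (by
    ext i
    simpa using congrFun h i))
  simpa using this

lemma nontrivial_vec (hd : 0 < d) : Nontrivial (Vec d) := by
  have : Nonempty (Fin d) := ⟨⟨0, hd⟩⟩
  infer_instance

lemma posDef_exists_lower (hd : 0 < d) {Q : Mat d} (hQ : Q.PosDef) :
    ∃ l > 0, ∀ x : Vec d, l * ‖x‖ ^ 2 ≤ inner ℝ (opOf Q x) x := by
  have := nontrivial_vec hd
  have hne : (Metric.sphere (0 : Vec d) 1).Nonempty := NormedSpace.sphere_nonempty.2 zero_le_one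
  have hcont : Continuous fun x : Vec d => inner ℝ (opOf Q x) x := by fun_prop
  obtain ⟨x₀, hx₀, hmin⟩ := (isCompact_sphere (0 : Vec d) 1).exists_isMinOn hne hcont.continuousOn
  have hx₀' : x₀ ≠ 0 := by
    rintro rfl
    simp at hx₀
  refine ⟨_, posDef_inner_opOf_pos hQ hx₀', fun x => ?_⟩
  rcases eq_or_ne x 0 with rfl | hx
  · simp
  have hn : 0 < ‖x‖ := norm_pos_iff.2 hx
  have h1 := hmin (a := ‖x‖⁻¹ • x) (by
    rw [mem_sphere_zero_iff_norm, norm_smul, norm_inv, norm_norm, inv_mul_cancel₀ hn.ne'])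
  simp only [Set.mem_ofPred_eq, map_smul, inner_smul_left, inner_smul_right, conj_trivial] at h1
  calc _ ≤ (‖x‖⁻¹ * (‖x‖⁻¹ * inner ℝ (opOf Q x) x)) * ‖x‖ ^ 2 := by gcongr
    _ = _ := by field_simp

lemma specNorm_nonneg (A : Mat d) : 0 ≤ specNorm A := norm_nonneg _

lemma posDef_specNorm_pos (hd : 0 < d) {Q : Mat d} (hQ : Q.PosDef) : 0 < specNorm Q := by
  have := nontrivial_vec hd
  obtain ⟨x, hx⟩ := exists_ne (0 : Vec d)
  refine (specNorm_nonneg Q).lt_of_ne fun h => ?_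
  have h1 := posDef_inner_opOf_pos hQ hx
  rw [norm_eq_zero.1 (show ‖opOf Q‖ = 0 from h.symm)] at h1
  simp at h1

lemma inner_opOf_le (Q : Mat d) (x : Vec d) : inner ℝ (opOf Q x) x ≤ specNorm Q * ‖x‖ ^ 2 := by
  refine (real_inner_le_norm _ _).trans ?_
  rw [sq, ← mul_assoc]
  gcongr
  exact (opOf Q).le_opNorm x

lemma posDef_isLyapunov (hd : 0 < d) {B Q : Mat d} (hQ : Q.PosDef) (h : Bᵀ * Q + Q * B = 1) :
    ∃ l, IsLyapunov (opOf B) (opOf Q) l (specNorm Q) := by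
  obtain ⟨l, hl, hlow⟩ := posDef_exists_lower hd hQ
  refine ⟨l, hl, posDef_specNorm_pos hd hQ, inner_opOf_symm (posDef_transpose_eq hQ), hlow,
    inner_opOf_le Q, fun x => ?_⟩
  rw [two_mul_inner_opOf (posDef_transpose_eq hQ) h, opOf, map_one]
  simp

lemma posDef_one_le_condNumber (hd : 0 < d) {Q : Mat d} (hQ : Q.PosDef) : 1 ≤ condNumber Q := by
  have : Nonempty (Fin d) := ⟨⟨0, hd⟩⟩
  have hs := hQ.isHermitian.spectrum_real_eq_range_eigenvalues
  have hne : (spectrum ℝ Q).Nonempty := hs ▸ Set.range_nonempty _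
  have hfin : (spectrum ℝ Q).Finite := hs ▸ Set.finite_range _
  have hmem := hne.csInf_mem hfin
  have hpos : 0 < sInf (spectrum ℝ Q) := by
    have h1 : sInf (spectrum ℝ Q) ∈ Set.range hQ.isHermitian.eigenvalues := hs ▸ hmem
    obtain ⟨i, hi⟩ := h1
    rw [← hi]
    exact hQ.eigenvalues_pos i
  rw [condNumber, one_le_div hpos]
  exact le_csSup hfin.bddAbove hmem

lemma vecNormQ_eq {Q : Mat d} (x : Vec d) : vecNormQ Q x = √(inner ℝ x (opOf Q x)) := by
  rw [inner_opOf]; rfl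

lemma posDef_opNormQ_pos (hd : 0 < d) {Q A : Mat d} (hQ : Q.PosDef)
    (hA : ∀ x : Vec d, x ≠ 0 → act A x ≠ 0) : 0 < opNormQ Q A := by
  have := nontrivial_vec hd
  have hform : ∀ x : Vec d, inner ℝ x (opOf Q x) = inner ℝ (opOf Q x) x := fun x =>
    real_inner_comm _ _
  obtain ⟨l, hl, hlow⟩ := posDef_exists_lower hd hQ
  obtain ⟨x, hx⟩ := exists_ne (0 : Vec d)
  have hq := posDef_inner_opOf_pos hQ hx
  set c := (√(inner ℝ (opOf Q x) x))⁻¹ with hc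
  have hc0 : 0 < c := by positivity
  have hcx : vecNormQ Q (c • x) = 1 := by
    rw [vecNormQ_eq, hform]
    simp only [map_smul, inner_smul_left, inner_smul_right, conj_trivial]
    rw [← mul_assoc, ← sq, Real.sqrt_mul (sq_nonneg c), Real.sqrt_sq hc0.le, hc,
      inv_mul_cancel₀ (by positivity)]
  have hpos : 0 < vecNormQ Q (act A (c • x)) := by
    rw [vecNormQ_eq, hform]
    exact Real.sqrt_pos.2 (posDef_inner_opOf_pos hQ (hA _ (smul_ne_zero hc0.ne' hx)))
  -- The supremum of an unbounded set of reals is 0 by convention, so an upper bound must be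
  -- exhibited; it uses that ‖y‖_Q = 1 forces ‖y‖² ≤ 1/l.
  refine hpos.trans_le (le_csSup ⟨√(specNorm Q * (specNorm A ^ 2 * l⁻¹)), ?_⟩ ⟨_, hcx, rfl⟩)
  rintro _ ⟨y, hy, rfl⟩
  rw [vecNormQ_eq, hform] at hy ⊢
  refine Real.sqrt_le_sqrt ((inner_opOf_le Q _).trans ?_)
  have h1 : ‖y‖ ^ 2 ≤ l⁻¹ := by
    rw [Real.sqrt_eq_one] at hy
    rw [← one_div, le_div_iff₀ hl, mul_comm, ← hy]
    exact hlow y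
  have h2 : ‖act A y‖ ^ 2 ≤ specNorm A ^ 2 * ‖y‖ ^ 2 := by
    rw [← mul_pow]
    gcongr
    exact (opOf A).le_opNorm y
  have h3 := specNorm_nonneg Q
  calc specNorm Q * ‖act A y‖ ^ 2 ≤ specNorm Q * (specNorm A ^ 2 * ‖y‖ ^ 2) := by gcongr
    _ ≤ _ := by gcongr

lemma posDef_alphaMax_pos (hd : 0 < d) {Q A : Mat d} {CA : ℝ} (hCA : 0 < CA) (hQ : Q.PosDef)
    (hA : ∀ x : Vec d, x ≠ 0 → act A x ≠ 0) : 0 < alphaMax A Q CA 2 := by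
  have h1 := posDef_opNormQ_pos hd hQ hA
  have h2 := posDef_specNorm_pos hd hQ
  have h3 := posDef_one_le_condNumber hd hQ
  have h4 : 0 < condNumber Q := by linarith
  rw [alphaMax, alphaInf, rate, bQ, lt_min_iff]
  constructor
  · positivity
  · rw [show (2 : ℝ) - 1 = 1 by norm_num]
    positivity

/-- The second entry of the minimum is 1/(16 κ_Q ‖Q‖ C_A²), and κ_Q ≥ 1. -/
lemma posDef_mul_le_of_le_alphaMax (hd : 0 < d) {Q A : Mat d} {CA α : ℝ} (hCA : 0 < CA)
    (hQ : Q.PosDef) (hα : α ≤ alphaMax A Q CA 2) : α * (specNorm Q * CA ^ 2) ≤ 1 / 4 := by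
  have h2 := posDef_specNorm_pos hd hQ
  have h3 := posDef_one_le_condNumber hd hQ
  have h4 : 0 < condNumber Q := by linarith
  have h5 : α ≤ rate Q / (2 * bQ Q CA ^ 2 * (2 - 1)) := hα.trans (min_le_right _ _)
  have h6 : rate Q / (2 * bQ Q CA ^ 2 * (2 - 1))
      = (16 * condNumber Q * (specNorm Q * CA ^ 2))⁻¹ := by
    rw [rate, bQ, mul_pow, mul_pow, Real.sq_sqrt h4.le]
    field_simp
    norm_num
  rw [h6] at h5
  calc α * (specNorm Q * CA ^ 2)
      ≤ (16 * condNumber Q * (specNorm Q * CA ^ 2))⁻¹ * (specNorm Q * CA ^ 2) := by gcongr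
    _ = (16 * condNumber Q)⁻¹ := by field_simp
    _ ≤ 1 / 4 := by
      rw [one_div]
      exact inv_anti₀ (by norm_num) (by linarith)

lemma abs_apply_le_specNorm (A : Mat d) (i j : Fin d) : |A i j| ≤ specNorm A := by
  have h1 : A i j = inner ℝ (EuclideanSpace.single i (1 : ℝ))
      (opOf A (EuclideanSpace.single j (1 : ℝ))) := by
    rw [inner_opOf]
    simp
  rw [h1]
  refine (abs_real_inner_le_norm _ _).trans ?_
  have := (opOf A).le_opNorm (EuclideanSpace.single j (1 : ℝ))
  simpa [specNorm] using this

end MatrixFacts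

/-! ### From the noise assumption to the centered recursion. -/

section NoiseFacts

variable {d : ℕ} {Ω : Type*} [MeasurableSpace Ω] {P : Measure Ω} [IsProbabilityMeasure P]
  {A : ℕ → Ω → Mat d} {b : ℕ → Ω → Vec d} {CA Cb : ℝ}

omit [IsProbabilityMeasure P] in
lemma measurable_entry {M : Ω → Mat d} (hM : Measurable M) (i j : Fin d) :
    Measurable fun ω => M ω i j :=
  (measurable_pi_apply j).comp ((measurable_pi_apply i).comp hM)

omit [IsProbabilityMeasure P] in
lemma measurable_act {M : Ω → Mat d} (hM : Measurable M) (x : Vec d) :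
    Measurable fun ω => act (M ω) x := by
  refine (WithLp.measurable_toLp 2 _).comp (measurable_pi_lambda _ fun i => ?_)
  simp only [Matrix.mulVec, dotProduct]
  exact Finset.measurable_sum _ fun j _ => (measurable_entry hM i j).mul_const _

lemma NoiseAssumption.integrable_entry (h : NoiseAssumption P A b CA Cb) (i j : Fin d) :
    Integrable (fun ω => A 0 ω i j) P := by
  refine Integrable.of_bound (measurable_entry (h.measurable_A 0) i j).aestronglyMeasurable CA ?_
  filter_upwards [h.bounded] with ω hω
  exact (abs_apply_le_specNorm _ i j).trans hω

lemma NoiseAssumption.integral_inner_act (h : NoiseAssumption P A b CA Cb) (x u : Vec d) :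
    ∫ ω, inner ℝ u (act (A 0 ω) x) ∂P = inner ℝ u (act (matMean P (A 0)) x) := by
  simp only [act_eq_opOf, inner_opOf, Matrix.mulVec, dotProduct, matMean, Matrix.of_apply]
  have hint : ∀ i j, Integrable (fun ω => A 0 ω i j * x.ofLp j) P := fun i j =>
    (h.integrable_entry i j).mul_const _
  rw [integral_finsetSum _ fun i _ => (integrable_finsetSum _ fun j _ => hint i j).const_mul _]
  refine Finset.sum_congr rfl fun i _ => ?_
  rw [integral_const_mul, integral_finsetSum _ fun j _ => hint i j]
  simp_rw [integral_mul_const]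

omit [IsProbabilityMeasure P] in
-- Each coordinate is sub-Gaussian and so has all moments; the third is the one that the Taylor
-- remainder requires.
lemma NoiseAssumption.memLp_centered (h : NoiseAssumption P A b CA Cb) :
    MemLp (fun ω => b 0 ω - vecMean P (b 0)) 3 P := by
  have h1 : ∀ v : Vec d, v = ∑ i, inner ℝ (EuclideanSpace.single i (1 : ℝ)) v •
      EuclideanSpace.single i (1 : ℝ) := by
    intro v
    have := (EuclideanSpace.basisFun (Fin d) ℝ).sum_repr' v
    simpa using this.symm
  have h2 : (fun ω => b 0 ω - vecMean P (b 0)) = fun ω => ∑ i,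
      inner ℝ (EuclideanSpace.single i (1 : ℝ)) (b 0 ω - vecMean P (b 0)) •
      (EuclideanSpace.single i (1 : ℝ) : Vec d) := by
    funext ω
    exact h1 _
  rw [h2]
  refine memLp_finsetSum _ fun i _ => ?_
  have h3 := (h.subGaussian (EuclideanSpace.single i (1 : ℝ)) (by simp)).memLp 3
  refine MemLp.of_le_mul (c := 1) h3 ?_ (.of_forall fun ω => ?_)
  · exact (h3.1.smul_const _)
  · rw [norm_smul]
    simp

/-- Integrability of `b 0` is not assumed: it follows from that of the difference with a constant
vector, whatever that constant is. -/
lemma NoiseAssumption.memLp_vector (h : NoiseAssumption P A b CA Cb) : MemLp (b 0) 3 P := by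
  have := h.memLp_centered.add (memLp_const (vecMean P (b 0)))
  refine this.congr_norm (h.measurable_b 0).aestronglyMeasurable (.of_forall fun ω => ?_)
  simp

omit [IsProbabilityMeasure P] in
lemma noise_eq {θs : Vec d} (hθ : act (matMean P (A 0)) θs = vecMean P (b 0)) (ω : Ω) :
    noise P A b θs ω = b 0 ω - act (A 0 ω) θs := by
  have : act (A 0 ω - matMean P (A 0)) θs = act (A 0 ω) θs - act (matMean P (A 0)) θs := by
    simp only [act_eq_opOf, opOf, map_sub]
    rfl
  rw [noise, this, hθ]
  abel

lemma NoiseAssumption.centeredNoise (h : NoiseAssumption P A b CA Cb) {θs : Vec d}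
    (hθ : act (matMean P (A 0)) θs = vecMean P (b 0)) :
    CenteredNoise P (fun ω => opOf (A 0 ω)) (noise P A b θs) (opOf (matMean P (A 0))) CA := by
  have hactm := measurable_act (h.measurable_A 0)
  have hact : ∀ x, MemLp (fun ω => act (A 0 ω) x) 3 P := by
    intro x
    refine MemLp.of_bound (hactm x).aestronglyMeasurable (CA * ‖x‖) ?_
    filter_upwards [h.bounded] with ω hω
    exact (opOf (A 0 ω)).le_of_opNorm_le hω x
  have hnoise : noise P A b θs = fun ω => b 0 ω - act (A 0 ω) θs := funext (noise_eq hθ)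
  refine ⟨hactm, ?_, h.bounded, h.integral_inner_act, ?_, fun u => ?_⟩
  · rw [hnoise]
    exact (h.measurable_b 0).sub (hactm θs)
  · rw [hnoise]
    exact h.memLp_vector.sub (hact θs)
  · have hbi := h.memLp_vector.integrable (by norm_num)
    have hai := (hact θs).integrable (by norm_num)
    simp_rw [hnoise, inner_sub_right]
    rw [integral_sub (hbi.const_inner u) (hai.const_inner u), h.integral_inner_act, hθ,
      integral_inner hbi, vecMean, sub_self]

/-- Recentring at θ*: Aθ − b = A(θ − θ*) − ε. -/
lemma NoiseAssumption.kernel_apply_eq (h : NoiseAssumption P A b CA Cb) {θs : Vec d}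
    (hθ : act (matMean P (A 0)) θs = vecMean P (b 0)) (α : ℝ) (θ : Vec d) :
    kernel (P.map fun ω => (A 0 ω, b 0 ω)) α θ
      = P.map (centeredStep (fun ω => opOf (A 0 ω)) (noise P A b θs) θs α θ) := by
  have hm : Measurable fun ω => (A 0 ω, b 0 ω) := (h.measurable_A 0).prodMk (h.measurable_b 0)
  have hs : Measurable fun p : Mat d × Vec d => θ - α • (act p.1 θ - p.2) :=
    (measurable_step α).comp (measurable_const.prodMk measurable_id)
  rw [kernel_apply, Measure.map_map hs hm]
  congr 1
  funext ω
  simp only [Function.comp, centeredStep, noise_eq hθ, act_eq_opOf, map_sub]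
  module

lemma NoiseAssumption.isMarkovKernel (h : NoiseAssumption P A b CA Cb) (α : ℝ) :
    IsMarkovKernel (kernel (P.map fun ω => (A 0 ω, b 0 ω)) α) := by
  have hm : Measurable fun ω => (A 0 ω, b 0 ω) := (h.measurable_A 0).prodMk (h.measurable_b 0)
  have := Measure.isProbabilityMeasure_map (μ := P) hm.aemeasurable
  exact Kernel.IsMarkovKernel.map _ (measurable_step α)

lemma CenteredNoise.inner_noiseCov {θs : Vec d} {M : Ω → Vec d →L[ℝ] Vec d}
    {Mbar : Vec d →L[ℝ] Vec d} {K : ℝ} (h : CenteredNoise P M (noise P A b θs) Mbar K) (t : Vec d) :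
    inner ℝ t (opOf (noiseCov P A b θs) t) = noiseForm P (noise P A b θs) t := by
  set ε := noise P A b θs with hε
  have hcoord : ∀ i, MemLp (fun ω => (ε ω).ofLp i) 2 P := by
    intro i
    refine h.memLp_two.of_le ?_ (.of_forall fun ω => PiLp.norm_apply_le _ i)
    have := h.measurable_eps
    exact Measurable.aestronglyMeasurable (by fun_prop)
  have hint : ∀ i j, Integrable (fun ω => (ε ω).ofLp i * (ε ω).ofLp j) P := fun i j =>
    (hcoord i).integrable_mul (hcoord j)
  have hsq : ∀ ω, inner ℝ (ε ω) t ^ 2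
      = ∑ i, ∑ j, t.ofLp i * ((ε ω).ofLp i * (ε ω).ofLp j) * t.ofLp j := by
    intro ω
    rw [PiLp.inner_apply, sq, Finset.sum_mul_sum]
    refine Finset.sum_congr rfl fun i _ => Finset.sum_congr rfl fun j _ => ?_
    simp
    ring
  simp_rw [noiseForm, hsq]
  rw [integral_finsetSum _ fun i _ => integrable_finsetSum _ fun j _ =>
    ((hint i j).const_mul _).mul_const _, inner_opOf]
  simp only [Matrix.mulVec, dotProduct, Finset.mul_sum]
  refine Finset.sum_congr rfl fun i _ => ?_
  rw [integral_finsetSum _ fun j _ => ((hint i j).const_mul _).mul_const _]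
  refine Finset.sum_congr rfl fun j _ => ?_
  rw [integral_mul_const, integral_const_mul, ← mul_assoc]
  rfl

lemma CenteredNoise.posSemidef_noiseCov {θs : Vec d} {M : Ω → Vec d →L[ℝ] Vec d}
    {Mbar : Vec d →L[ℝ] Vec d} {K : ℝ} (h : CenteredNoise P M (noise P A b θs) Mbar K) :
    (noiseCov P A b θs).PosSemidef := by
  refine Matrix.PosSemidef.of_dotProduct_mulVec_nonneg ?_ fun x => ?_
  · ext i j
    simp [noiseCov, matMean, Matrix.vecMulVec_apply, mul_comm]
  · have h1 := h.inner_noiseCov (WithLp.toLp 2 x)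
    rw [inner_opOf] at h1
    have h2 := noiseForm_nonneg (P := P) (ε := noise P A b θs) (WithLp.toLp 2 x)
    rw [← h1] at h2
    simpa using h2

omit [IsProbabilityMeasure P] in
lemma charFun_map_rescaled_error {Ω' : Type*} [MeasurableSpace Ω'] {μ : Measure Ω'}
    {X : Ω' → Vec d} {π : Measure (Vec d)} (hX : HasLaw X π μ) (θs : Vec d) {α : ℝ} (hα : 0 < α)
    (t : Vec d) :
    charFun (μ.map fun ω => α ^ (-(1 / 2) : ℝ) • (X ω - θs)) t = errorCharFun π θs √α t := by
  have hXm := hX.aemeasurable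
  have e : α ^ (-(1 / 2) : ℝ) = (√α)⁻¹ := by
    rw [Real.rpow_neg hα.le, Real.sqrt_eq_rpow]
  rw [charFun_apply, integral_map (by fun_prop) (by fun_prop), errorCharFun, ← hX.map_eq,
    integral_map hXm (by fun_prop), e]

end NoiseFacts

end LSA

end

/-! ### The theorem. -/

open LSA in
theorem theorem3 {d : ℕ} (hd : 0 < d) {Ω : Type*} [MeasurableSpace Ω]
    (P : Measure Ω) [IsProbabilityMeasure P]
    (A : ℕ → Ω → LSA.Mat d) (b : ℕ → Ω → LSA.Vec d) (CA Cb : ℝ)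
    (hnoise : LSA.NoiseAssumption P A b CA Cb) :
    -- the unique solution `θ*` of `Ā θ = b̄`
    ∃ θstar : LSA.Vec d,
      (∀ θ : LSA.Vec d,
        LSA.act (LSA.matMean P (A 0)) θ = LSA.vecMean P (b 0) ↔ θ = θstar) ∧
    -- the unique positive definite solution `Q` of `Āᵀ Q + Q Ā = I`
    ∃ Q : LSA.Mat d,
      (∀ Q' : LSA.Mat d,
        (Q'.PosDef ∧ (LSA.matMean P (A 0))ᵀ * Q' + Q' * LSA.matMean P (A 0) = 1) ↔ Q' = Q) ∧
      0 < LSA.alphaMax (LSA.matMean P (A 0)) Q CA 2 ∧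
    -- the unique solution `S` of `Ā S + S Āᵀ = Σ_ε`, a covariance matrix
    ∃ S : LSA.Mat d,
      (∀ S' : LSA.Mat d,
        LSA.matMean P (A 0) * S' + S' * (LSA.matMean P (A 0))ᵀ = LSA.noiseCov P A b θstar ↔
          S' = S) ∧
      S.PosSemidef ∧
    -- the unique stationary law for each step size in `(0, α_{2,∞}]`
    ∃ π : Set.Ioc (0 : ℝ) (LSA.alphaMax (LSA.matMean P (A 0)) Q CA 2) → Measure (LSA.Vec d),
      (∀ α : Set.Ioc (0 : ℝ) (LSA.alphaMax (LSA.matMean P (A 0)) Q CA 2),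
        (∀ ρ : Measure (LSA.Vec d), LSA.IsStationary P A b (α : ℝ) ρ ↔ ρ = π α) ∧
        MemLp id 2 (π α)) ∧
    -- convergence in law as `α ↓ 0`
    ∀ (Ω' : Set.Ioc (0 : ℝ) (LSA.alphaMax (LSA.matMean P (A 0)) Q CA 2) → Type*)
      [∀ α, MeasurableSpace (Ω' α)] (μ : ∀ α, Measure (Ω' α)) [∀ α, IsProbabilityMeasure (μ α)]
      (θinf : ∀ α, Ω' α → LSA.Vec d), (∀ α, HasLaw (θinf α) (π α) (μ α)) →
        TendstoInDistribution
          (fun α (ω : Ω' α) => (α : ℝ) ^ (-(1 / 2) : ℝ) • (θinf α ω - θstar))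
          (comap (fun α => (α : ℝ)) (𝓝[>] (0 : ℝ)))
          (id : LSA.Vec d → LSA.Vec d) μ (multivariateGaussian 0 S) := by

  have hstable := hnoise.hurwitz.isPositiveStable
  set Abar := matMean P (A 0) with hAbar
  have hdet := hstable.isUnit_det
  have hinj : ∀ x : Vec d, x ≠ 0 → act Abar x ≠ 0 := by
    intro x hx h0
    refine hstable.mulVec_ne le_rfl (v := x.ofLp) (fun h => hx ?_) ?_
    · ext i
      simpa using congrFun h i
    · rw [zero_smul]
      simpa [act] using h0
  obtain ⟨θs, hθs⟩ : ∃ θs : Vec d, act Abar θs = vecMean P (b 0) := by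
    refine ⟨WithLp.toLp 2 (Abar⁻¹ *ᵥ (vecMean P (b 0)).ofLp), ?_⟩
    rw [act, Matrix.mulVec_mulVec, Matrix.mul_nonsing_inv _ hdet, Matrix.one_mulVec]
  obtain ⟨Q, hQ, hQu⟩ := hstable.existsUnique_lyapunov 1
  have hQpos := hstable.lyapunov_posDef hQ Matrix.PosDef.one
  -- A second Lyapunov solution, for Āᵀ: it measures the contraction of frequencies, as `Q` does
  -- that of states.
  obtain ⟨Q', hQ', -⟩ := hstable.transpose.existsUnique_lyapunov 1
  have hQ'pos := hstable.transpose.lyapunov_posDef hQ' Matrix.PosDef.one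
  obtain ⟨l, hL⟩ := posDef_isLyapunov hd hQpos hQ
  obtain ⟨l', hL'⟩ := posDef_isLyapunov hd hQ'pos hQ'
  have hcn := hnoise.centeredNoise hθs
  obtain ⟨S, hS, hSu⟩ := hstable.transpose.existsUnique_lyapunov (noiseCov P A b θs)
  have hSpos := hstable.transpose.lyapunov_posSemidef hS hcn.posSemidef_noiseCov
  have hsmall : ∀ α : Set.Ioc (0 : ℝ) (alphaMax Abar Q CA 2),
      (α : ℝ) * (specNorm Q * CA ^ 2) ≤ 1 / 4 := fun α =>
    posDef_mul_le_of_le_alphaMax hd hnoise.CA_pos hQpos α.2.2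
  have hM : ∀ α : ℝ, IsMarkovKernel (kernel (P.map fun ω => (A 0 ω, b 0 ω)) α) :=
    hnoise.isMarkovKernel
  have hker := hnoise.kernel_apply_eq hθs
  choose π hπprob hπinv hπ2 using fun α : Set.Ioc (0 : ℝ) (alphaMax Abar Q CA 2) =>
    hcn.exists_invariant hL α.2.1 (hsmall α) (hker α)
  refine ⟨θs, fun θ => ⟨fun h => ?_, fun h => h ▸ hθs⟩, Q, fun X => ⟨fun h => hQu X h.2,
    fun h => h ▸ ⟨hQpos, hQ⟩⟩, posDef_alphaMax_pos hd hnoise.CA_pos hQpos hinj, S,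
    fun X => ⟨fun h => hSu X (by rwa [Matrix.transpose_transpose]), fun h => ?_⟩, hSpos, π,
    fun α => ⟨fun ρ => ⟨fun h => ?_, fun h => h ▸ ⟨hπprob α, hπinv α⟩⟩, hπ2 α⟩, ?_⟩
  · by_contra hne
    refine hinj (θ - θs) (sub_ne_zero.2 hne) ?_
    rw [act_eq_opOf, map_sub, ← act_eq_opOf, ← act_eq_opOf, h, hθs, sub_self]
  · rw [h]
    rwa [Matrix.transpose_transpose] at hS
  · have := h.1
    exact hcn.invariant_unique hL α.2.1 (hsmall α) (hker α) h.2 (hπinv α)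
  intro Ω' _ μ _ θinf hlaw
  have hSsymm : Sᵀ = S := hstable.transpose.lyapunov_isSymm hS
    (by simpa [Matrix.IsHermitian] using hcn.posSemidef_noiseCov.1)
  have hS_form : ∀ t : Vec d, inner ℝ (opOf S t) t = t.ofLp ⬝ᵥ (S *ᵥ t.ofLp) := fun t => by
    rw [inner_opOf_symm hSsymm, inner_opOf]
  refine ⟨fun α => ?_, by fun_prop, ?_⟩
  · have := (hlaw α).aemeasurable
    fun_prop
  -- The filter is countably generated, so Lévy's theorem is applied along sequences of step sizes.
  refine tendsto_of_seq_tendsto fun a ha => ?_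
  have ha' : Tendsto (fun n => (a n : ℝ)) atTop (𝓝[>] 0) := tendsto_comap_iff.1 ha
  have ha0 : Tendsto (fun n => √(a n : ℝ)) atTop (𝓝 0) := by
    have := (Real.continuous_sqrt.tendsto 0).comp (ha'.mono_right nhdsWithin_le_nhds)
    simpa [Function.comp_def] using this
  refine ProbabilityMeasure.tendsto_of_tendsto_charFun fun t => ?_
  change Tendsto (fun n => charFun ((μ (a n)).map fun ω =>
    (a n : ℝ) ^ (-(1 / 2) : ℝ) • (θinf (a n) ω - θs)) t) atTop
    (𝓝 (charFun ((multivariateGaussian 0 S).map id) t))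
  rw [Measure.map_id, charFun_multivariateGaussian hSpos]
  have hlim : Complex.exp ((inner ℝ t 0 : ℝ) * Complex.I - (t.ofLp ⬝ᵥ (S *ᵥ t.ofLp) : ℝ) / 2)
      = Real.exp (-inner ℝ (opOf S t) t / 2) := by
    rw [hS_form, inner_zero_right]
    push_cast
    congr 1
    ring
  rw [hlim]
  obtain ⟨C, s₀, hs₀, hC⟩ := hcn.exists_norm_errorCharFun_sub_exp_le (θs := θs) hnoise.CA_pos.le hL
    (by rwa [adjoint_opOf]) (inner_opOf_symm hSsymm)
    (fun t => by
      rw [hS_form]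
      simpa using hSpos.dotProduct_mulVec_nonneg t.ofLp)
    (fun t => by
      rw [adjoint_opOf, two_mul_inner_opOf hSsymm hS, hcn.inner_noiseCov]) t
  rw [tendsto_iff_norm_sub_tendsto_zero]
  refine squeeze_zero' (.of_forall fun _ => norm_nonneg _) ?_
    (by simpa using ha0.const_mul C)
  filter_upwards [ha0.eventually (gt_mem_nhds hs₀)] with n hn
  have hpos : 0 < (a n : ℝ) := (a n).2.1
  rw [charFun_map_rescaled_error (hlaw (a n)) θs hpos]
  have := hπprob (a n)
  refine hC √(a n) (Real.sqrt_pos.2 hpos) hn.le (kernel (P.map fun ω => (A 0 ω, b 0 ω)) (a n))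
    (fun θ => ?_) (π (a n)) (hπinv (a n)) (hπ2 (a n))
  rw [Real.sq_sqrt hpos.le]
  exact hker (a n) θ
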